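/- In \textsc{List 3-Coloring}, an instance is a pair $(G,L)$, where $G=(V,E)$ is a finite simple graph and every vertex $v\in V$ has a list $L(v)\subseteq\{1,2,3\}$. The task is to decide whether there is a proper coloring $\varphi:V\to\{1,2,3\}$ of $G$ (that is, $\varphi(u)\neq\varphi(v)$ for every edge $uv$) with $\varphi(v)\in L(v)$ for all $v\in V$, and to output such a coloring if one exists. Theorem. \textsc{List 3-Coloring} on $n$-vertex graphs of diameter $2$ can be solved by a deterministic algorithm in time $2^{\mathcal{O}(n^{1/3}\log^{2} n)}$. That is, there are a single program $P$ for a random-access machine and a constant $C$ such that, for every $n$-vertex graph $G$ whose diameter (the maximum distance between two vertices) is $2$ and every list assignment $L$, the program $P$, started on $(G,L)$ (given by $n$, the adjacency matrix of $G$, and the incidence table of the lists), halts after at most $2^{C n^{1/3}\log^{2} n}$ steps, where $\log$ is the natural logarithm; it answers whether $(G,L)$ has a coloring as above, and outputs one if so. The machine has unlimited memory cells holding natural numbers and indirect addressing, its arithmetic operations are addition and truncated subtraction, and each operation costs one step. -/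

import Mathlib

/-! ## Random-access machine programs and their running time

The memory consists of countably many arrays of natural numbers, each indexed by the natural
numbers.  A program mentions only finitely many arrays (by fixed names), indexes them by computed
values (indirect addressing), and has addition and truncated subtraction as its only arithmetic
operations.  Every operation that is executed costs one step.  There is deliberately no
multiplication: as in the usual unit-cost RAM with `+` and `-`, the numbers that occur in `t` steps
have only `O(t)` bits more than the input and the constants of the program, so the step count is
polynomially related to the running time of a multitape Turing machine. -/

namespace RAM

/-- A memory state: `s a i` is the content of cell `i` of array `a`. -/
abbrev State : Type := ℕ → ℕ → ℕ

/-- Arithmetic expressions. -/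
inductive Expr : Type
  | const (k : ℕ)
  | read (a : ℕ) (i : Expr)
  | add (e f : Expr)
  | sub (e f : Expr)

/-- The value of an expression in a memory state; subtraction is truncated at `0`. -/
def Expr.eval (s : State) : Expr → ℕ
  | .const k => k
  | .read a i => s a (i.eval s)
  | .add e f => e.eval s + f.eval s
  | .sub e f => e.eval s - f.eval s

/-- The number of steps needed to evaluate an expression: one for each of its nodes. -/
def Expr.cost : Expr → ℕ
  | .const _ => 1
  | .read _ i => i.cost + 1
  | .add e f => e.cost + f.cost + 1
  | .sub e f => e.cost + f.cost + 1

/-- Programs.  A test succeeds when the value of the expression is not `0`. -/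
inductive Program : Type
  | skip
  | write (a : ℕ) (i e : Expr)
  | seq (P Q : Program)
  | ite (e : Expr) (P Q : Program)
  | while (e : Expr) (P : Program)

/-- The memory state `s` after writing `x` into cell `i` of array `a`. -/
def State.set (s : State) (a i x : ℕ) : State :=
  Function.update s a (Function.update (s a) i x)

/-- `Exec P s t s'`: the program `P`, started in the memory state `s`, halts after exactly `t` steps
in the memory state `s'`. -/
inductive Exec : Program → State → ℕ → State → Prop
  | skip (s : State) : Exec .skip s 1 s
  | write (s : State) (a : ℕ) (i e : Expr) :
      Exec (.write a i e) s (i.cost + e.cost + 1) (s.set a (i.eval s) (e.eval s))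
  | seq {P Q : Program} {s s' s'' : State} {t t' : ℕ} :
      Exec P s t s' → Exec Q s' t' s'' → Exec (.seq P Q) s (t + t') s''
  | ite_true {e : Expr} {P Q : Program} {s s' : State} {t : ℕ} :
      e.eval s ≠ 0 → Exec P s t s' → Exec (.ite e P Q) s (e.cost + 1 + t) s'
  | ite_false {e : Expr} {P Q : Program} {s s' : State} {t : ℕ} :
      e.eval s = 0 → Exec Q s t s' → Exec (.ite e P Q) s (e.cost + 1 + t) s'
  | while_true {e : Expr} {P : Program} {s s' s'' : State} {t t' : ℕ} :
      e.eval s ≠ 0 → Exec P s t s' → Exec (.while e P) s' t' s'' →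
        Exec (.while e P) s (e.cost + 1 + t + t') s''
  | while_false {e : Expr} {P : Program} {s : State} :
      e.eval s = 0 → Exec (.while e P) s (e.cost + 1) s

/-- Programs are deterministic: the number of steps and the final memory state are determined by
the initial memory state. -/
theorem Exec.deterministic {P : Program} {s s₁ s₂ : State} {t₁ t₂ : ℕ}
    (h₁ : Exec P s t₁ s₁) (h₂ : Exec P s t₂ s₂) : t₁ = t₂ ∧ s₁ = s₂ := by
  induction h₁ generalizing t₂ s₂ with
  | skip s => cases h₂; exact ⟨rfl, rfl⟩
  | write s a i e => cases h₂; exact ⟨rfl, rfl⟩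
  | seq _ _ ih ih' =>
    cases h₂ with
    | seq h h' =>
      obtain ⟨rfl, rfl⟩ := ih h
      obtain ⟨rfl, rfl⟩ := ih' h'
      exact ⟨rfl, rfl⟩
  | ite_true hc _ ih =>
    cases h₂ with
    | ite_true _ h => obtain ⟨rfl, rfl⟩ := ih h; exact ⟨rfl, rfl⟩
    | ite_false h0 _ => exact absurd h0 hc
  | ite_false hc _ ih =>
    cases h₂ with
    | ite_true h0 _ => exact absurd hc h0
    | ite_false _ h => obtain ⟨rfl, rfl⟩ := ih h; exact ⟨rfl, rfl⟩
  | while_true hc _ _ ih ih' =>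
    cases h₂ with
    | while_true _ h h' =>
      obtain ⟨rfl, rfl⟩ := ih h
      obtain ⟨rfl, rfl⟩ := ih' h'
      exact ⟨rfl, rfl⟩
    | while_false h0 => exact absurd h0 hc
  | while_false hc =>
    cases h₂ with
    | while_true h0 _ _ => exact absurd hc h0
    | while_false _ => exact ⟨rfl, rfl⟩

end RAM

/-! ## List 3-Coloring -/

namespace ListThreeColoring

/-- `φ` is a solution of the List 3-Coloring instance `(G, L)`: a proper coloring of `G` that gives
every vertex a color from its list. -/
def IsSolution {n : ℕ} (G : SimpleGraph (Fin n)) (L : Fin n → Finset (Fin 3))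
    (φ : Fin n → Fin 3) : Prop :=
  (∀ u v : Fin n, G.Adj u v → φ u ≠ φ v) ∧ ∀ v : Fin n, φ v ∈ L v

open Classical in
/-- The initial memory state for the instance `(G, L)`.  Array `0` holds the number `n` of vertices
in its first cell, array `1` holds the adjacency matrix of `G` row by row (cell `u * n + v` for the
pair `(u, v)`), and array `2` holds the lists (cell `3 * v + c` tells whether the color `c` belongs
to the list of `v`).  All other cells hold `0`. -/
noncomputable def input {n : ℕ} (G : SimpleGraph (Fin n)) (L : Fin n → Finset (Fin 3)) :
    RAM.State := fun a i =>
  if a = 0 ∧ i = 0 then n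
  else if a = 1 ∧ ∃ u v : Fin n, G.Adj u v ∧ i = (u : ℕ) * n + (v : ℕ) then 1
  else if a = 2 ∧ ∃ (v : Fin n) (c : Fin 3), c ∈ L v ∧ i = 3 * (v : ℕ) + (c : ℕ) then 1
  else 0

/-- The final memory state `s` holds a correct answer for the instance `(G, L)`: either the instance
has a solution, the first cell of array `3` is `1`, and the first `n` cells of array `4` hold a
solution; or the instance has no solution and the first cell of array `3` is `0`. -/
def CorrectOutput {n : ℕ} (G : SimpleGraph (Fin n)) (L : Fin n → Finset (Fin 3))
    (s : RAM.State) : Prop :=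
  (s 3 0 = 1 ∧ ∃ φ : Fin n → Fin 3, IsSolution G L φ ∧ ∀ v : Fin n, s 4 (v : ℕ) = (φ v : ℕ)) ∨
  (s 3 0 = 0 ∧ ¬ ∃ φ : Fin n → Fin 3, IsSolution G L φ)

end ListThreeColoring

/-!
The algorithm guesses the colors of a small *seed*, a set `S` of vertices, and propagates.  A vertex
is forced once it lies in `S` or sees two colors in `S`, and every neighbor of a forced vertex loses
a color.  If no vertex is left without a forced neighbor, then all lists have size at most two, and
the rest is an instance of 2-SAT, solved here by trying the colors one vertex after the other and
propagating (`exists_respects_of_closed`).  So everything rests on `exists_seed`: each solution `φ`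
has a seed of size `O(k g)`, where `k` is about `n ^ (1 / 3)` and `g` is about `log n`.  There are
`(3 n) ^ O(k g)` guesses, which is `2 ^ O(n ^ (1 / 3) * log² n)`, and each costs a number of steps
polynomial in the number of guesses.

Since logarithmically many halvings suffice, the core is `exists_seed_of_monochromatic`: if `U` is a
set of vertices of one color `a`, then some `R` gives forced neighbors to a set of vertices of `U`
whose proportion is at least of order `#R / k`.  If some vertex has `#U / k` neighbors in `U`, it
serves as `R`.  If for some `v` of another color and some `u ∈ U` there are `#U / k` vertices
`p ∈ U` that have a common neighbor with `u` and `v`, then `R = {v, u}` will do, because that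
neighbor sees the two different colors of `u` and `v`.  In the remaining case, weight each vertex
`v` of a color other than `a` by its degree into `U`.  All degrees are below `#U / k` and
`n ≤ k ^ 3`, so the total weight is at most `k ^ 2 * #U`.  Two vertices `u, p` of `U` have a common
neighbor `w`, and as all of `U` is within distance two of `w`, the weighted vertices `v` adjacent to
`w` have total weight at least `#U / 2`.  Hence a random `v` connects a given pair `u, p` with
probability at least `1 / (2 k ^ 2)`.  No `v` connects `u` to more than `#U / k` vertices `p`, so
averaging yields `O(k)` vertices `v` that connect at least half of the `u` to at least `#U / (2 k)`
vertices `p` each (`exists_connecting_set`), and then `O(k)` vertices `p` suffice for a constant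
proportion of the `u` (`exists_hitting_set`).

The program is written with counting loops whose bounds are fixed beforehand, so that its final
state is given by a total function (`Cmd.run`) and its running time is polynomial in the loop bounds
(`Cmd.exec_toProgram`).  The final check of the coloring makes positive answers correct; negative
answers are correct because the guesses include the colors of every solution on its seed.
-/

/-! ### Seeds that reveal every vertex -/

namespace ListThreeColoring

open Finset
open scoped Classical

section Seeds

variable {V κ : Type*} (G : SimpleGraph V) (φ : V → κ)

/-- The color of `w` is forced by the seed `S`, a set of vertices whose `φ`-colors are known, when
`w` belongs to `S` or has neighbors of two different colors in `S`. -/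
def Forced (S : Finset V) (w : V) : Prop :=
  w ∈ S ∨ ∃ p ∈ S, ∃ q ∈ S, G.Adj w p ∧ G.Adj w q ∧ φ p ≠ φ q

variable {G φ} in
lemma Forced.mono {S T : Finset V} (h : S ⊆ T) {w : V} (hw : Forced G φ S w) :
    Forced G φ T w := by
  rcases hw with hw | ⟨p, hp, q, hq, hpq⟩
  · exact Or.inl (h hw)
  · exact Or.inr ⟨p, h hp, q, h hq, hpq⟩

variable [Fintype V]

/-- The vertices that have no neighbor whose color is forced by the seed `S`. -/
noncomputable def hidden (S : Finset V) : Finset V :=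
  univ.filter fun u => ∀ w, G.Adj u w → ¬ Forced G φ S w

variable {G φ}

lemma hidden_anti {S T : Finset V} (h : S ⊆ T) : hidden G φ T ⊆ hidden G φ S := by
  intro u hu
  simp only [hidden, mem_filter, mem_univ, true_and] at hu ⊢
  exact fun w hw hf => hu w hw (hf.mono h)

/-- Greedy selection with a bounded potential `f`: if as long as `Done` fails some extension of `Q`
pays for its size by an increase of `f`, then a set satisfying `Done` is reached whose size is paid
for by `f`. -/
lemma exists_of_potential {f : Finset V → ℕ} {F A B : ℕ} (hF : ∀ Q, f Q ≤ F)
    {Done : Finset V → Prop}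
    (step : ∀ Q, ¬ Done Q → ∃ R : Finset V, f Q < f (Q ∪ R) ∧
      #R * A + B * f Q ≤ B * f (Q ∪ R)) :
    ∃ Q, Done Q ∧ #Q * A ≤ B * f Q := by
  have key : ∀ d Q, F - f Q ≤ d → #Q * A ≤ B * f Q → ∃ Q, Done Q ∧ #Q * A ≤ B * f Q := by
    intro d
    induction d with
    | zero =>
      intro Q hd hQ
      by_contra hcon
      have hs : ¬ Done Q := fun h => hcon ⟨Q, h, hQ⟩
      obtain ⟨R, h1, -⟩ := step Q hs
      have := hF (Q ∪ R)
      omega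
    | succ d ih =>
      intro Q hd hQ
      by_cases hs : Done Q
      · exact ⟨Q, hs, hQ⟩
      obtain ⟨R, h1, h2⟩ := step Q hs
      refine ih (Q ∪ R) (by have := hF (Q ∪ R); omega) ?_
      calc #(Q ∪ R) * A ≤ (#Q + #R) * A := Nat.mul_le_mul_right _ (card_union_le _ _)
        _ = #Q * A + #R * A := by ring
        _ ≤ B * f Q + #R * A := by omega
        _ ≤ B * f (Q ∪ R) := by omega
  exact key _ ∅ le_rfl (by simp)

/-- In a graph in which any two nonadjacent vertices have a common neighbor, let `U` be a set of
vertices of one color `a`, and suppose that every vertex has few neighbors in `U`.  For `u, p ∈ U`,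
the vertices `v` of a color other than `a` that share a neighbor with both `u` and `p` then have,
counted with their degrees into `U`, total weight at least `#U / 2`: if `w` is a common neighbor of
`u` and `p`, then every vertex of `U` not adjacent to `w` is joined to `w` by such a `v`. -/
lemma card_le_two_mul_weight (hφ : ∀ u v, G.Adj u v → φ u ≠ φ v)
    (h2 : ∀ u v, ¬ G.Adj u v → ∃ w, G.Adj u w ∧ G.Adj w v) {U : Finset V} {a : κ}
    (hU : ∀ u ∈ U, φ u = a) (hdeg : ∀ v, 2 * #{u ∈ U | G.Adj v u} < #U) {u p : V} (hu : u ∈ U)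
    (hp : p ∈ U) :
    #U ≤ 2 * ∑ v with φ v ≠ a ∧ ∃ w, G.Adj u w ∧ G.Adj p w ∧ G.Adj v w,
      #{x ∈ U | G.Adj v x} := by
  have hnadj : ¬ G.Adj u p := fun h => hφ u p h ((hU u hu).trans (hU p hp).symm)
  obtain ⟨w, huw, hwp⟩ := h2 u p hnadj
  have hsub : ({x ∈ U | ¬ G.Adj w x} : Finset V) ⊆
      (univ.filter fun v => φ v ≠ a ∧ ∃ w, G.Adj u w ∧ G.Adj p w ∧ G.Adj v w).biUnion
        fun v => {x ∈ U | G.Adj v x} := by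
    intro x hx
    rw [mem_filter] at hx
    obtain ⟨v, hwv, hvx⟩ := h2 w x hx.2
    simp only [mem_biUnion, mem_filter, mem_univ, true_and]
    exact ⟨v, ⟨fun h => hφ v x hvx (h.trans (hU x hx.1).symm), w, huw, hwp.symm, hwv.symm⟩,
      hx.1, hvx⟩
  have h3 := (card_le_card hsub).trans card_biUnion_le
  have h4 := card_filter_add_card_filter_not (s := U) (fun x => G.Adj w x)
  have h5 := hdeg w
  omega

/-- If no vertex `v` of a color other than `a` shares neighbors with a vertex `p ∈ U` and with many
other vertices of `U`, then some set `Q` of at most `12 k` vertices is such that, for at least half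
of the `u ∈ U`, at least `#U / (2 k)` vertices `p ∈ U` have a common neighbor with `u` and some
element of `Q` of a color other than `a`.  The set `Q` is built one vertex at a time: as long as it
does not suffice, a vertex chosen at random with probability proportional to its degree into `U`
increases the number of connected pairs by at least `#U ^ 2 / (8 k ^ 2)` on average. -/
lemma exists_connecting_set (hφ : ∀ u v, G.Adj u v → φ u ≠ φ v)
    (h2 : ∀ u v, ¬ G.Adj u v → ∃ w, G.Adj u w ∧ G.Adj w v) {k : ℕ} (hk : 2 ≤ k)
    (hn : Fintype.card V ≤ k ^ 3) {U : Finset V} {a : κ} (hU : ∀ u ∈ U, φ u = a)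
    (hne : U.Nonempty) (hdeg : ∀ v, k * #{u ∈ U | G.Adj v u} < #U)
    (hpair : ∀ v, φ v ≠ a → ∀ u ∈ U,
      k * #{p ∈ U | ∃ w, G.Adj u w ∧ G.Adj p w ∧ G.Adj v w} < #U) :
    ∃ Q : Finset V, #Q ≤ 12 * k ∧
      #U < 2 * #{u ∈ U | #U ≤ 2 * k * #{p ∈ U | ∃ v ∈ Q,
        φ v ≠ a ∧ ∃ w, G.Adj u w ∧ G.Adj p w ∧ G.Adj v w}} := by
  set Good : V → V → V → Prop := fun u p v =>
    φ v ≠ a ∧ ∃ w, G.Adj u w ∧ G.Adj p w ∧ G.Adj v w with hGood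
  set M := #U with hM
  have hMpos : 0 < M := card_pos.mpr hne
  set A : V → ℕ := fun v => #{x ∈ U | G.Adj v x} with hA
  have hweight : ∀ u ∈ U, ∀ p ∈ U, M ≤ 2 * ∑ v with Good u p v, A v := fun u hu p hp =>
    card_le_two_mul_weight hφ h2 hU
      (fun v => lt_of_le_of_lt (Nat.mul_le_mul_right _ hk) (hdeg v)) hu hp
  have htotal : ∑ v, A v ≤ k ^ 2 * M := by
    have h1 : ∑ v, k * A v ≤ ∑ _v : V, M := sum_le_sum fun v _ => (hdeg v).le
    rw [← mul_sum, sum_const, card_univ, smul_eq_mul] at h1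
    have h3 : k * ∑ v, A v ≤ k * (k ^ 2 * M) :=
      h1.trans ((Nat.mul_le_mul_right _ hn).trans (by ring_nf; exact le_rfl))
    exact Nat.le_of_mul_le_mul_left h3 (by omega)
  set K : Finset V → V → Finset V := fun Q u => {p ∈ U | ∃ v ∈ Q, Good u p v} with hK
  -- The truncation at `3 * M` bounds the potential, and it does not affect the increase at vertices
  -- `u` that still lack connections: there `2 * k * #(K Q u) < M`, and one vertex adds at most
  -- `M / k` to `#(K Q u)`.
  set f : Finset V → ℕ := fun Q => ∑ u ∈ U, min (2 * k * #(K Q u)) (3 * M) with hf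
  have hfF : ∀ Q, f Q ≤ M * (3 * M) := fun Q => by
    refine (sum_le_card_nsmul _ _ (3 * M) fun u _ => min_le_right _ _).trans ?_
    simp [hM]
  have hdone := exists_of_potential (f := f) (F := M * (3 * M)) (A := M * M) (B := 4 * k) hfF
    (Done := fun Q => M < 2 * #{u ∈ U | M ≤ 2 * k * #(K Q u)}) ?_
  · obtain ⟨Q, hs, hQ⟩ := hdone
    refine ⟨Q, ?_, hs⟩
    have h1 : #Q * (M * M) ≤ 12 * k * (M * M) :=
      hQ.trans ((Nat.mul_le_mul_left _ (hfF Q)).trans (by ring_nf; exact le_rfl))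
    exact Nat.le_of_mul_le_mul_right h1 (Nat.mul_pos hMpos hMpos)
  intro Q hs
  -- The vertices that still lack connections.
  set Act : Finset V := {u ∈ U | ¬ M ≤ 2 * k * #(K Q u)} with hAct
  have hActM : M ≤ 2 * #Act := by
    have h1 : #{u ∈ U | M ≤ 2 * k * #(K Q u)} + #Act = M := by
      convert card_filter_add_card_filter_not (s := U) (fun u => M ≤ 2 * k * #(K Q u))
    have h3 : ¬ M < 2 * #{u ∈ U | M ≤ 2 * k * #(K Q u)} := hs
    omega
  set gain : V → V → ℕ := fun v u => #{p ∈ U \ K Q u | Good u p v} with hgain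
  have hActU : ∀ u ∈ Act, u ∈ U := fun u hu => (mem_filter.mp hu).1
  have hActK : ∀ u ∈ Act, 2 * k * #(K Q u) < M := fun u hu => not_le.mp (mem_filter.mp hu).2
  have hKU : ∀ u, K Q u ⊆ U := fun u => filter_subset _ _
  -- The weighted average over `v` of the total gain is at least `M ^ 2 / (8 * k ^ 2)`.
  have havg : M * (M * M) ≤ 8 * ∑ v, A v * ∑ u ∈ Act, gain v u := by
    have hswap : ∑ v, A v * ∑ u ∈ Act, gain v u
        = ∑ u ∈ Act, ∑ p ∈ U \ K Q u, ∑ v with Good u p v, A v := by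
      simp_rw [hgain, card_eq_sum_ones, sum_filter, mul_sum]
      rw [sum_comm]
      refine sum_congr rfl fun u _ => ?_
      rw [sum_comm]
      refine sum_congr rfl fun p _ => sum_congr rfl fun v _ => ?_
      split_ifs <;> simp
    rw [hswap]
    have h1 : ∀ u ∈ Act, M * M ≤ 4 * ∑ p ∈ U \ K Q u, ∑ v with Good u p v, A v := by
      intro u hu
      have h3 : #(U \ K Q u) * M ≤ ∑ p ∈ U \ K Q u, 2 * ∑ v with Good u p v, A v := by
        rw [← smul_eq_mul]
        exact card_nsmul_le_sum _ _ _ fun p hp =>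
          hweight u (hActU u hu) p (mem_sdiff.mp hp).1
      rw [← mul_sum] at h3
      have h4 : M ≤ 2 * #(U \ K Q u) := by
        have h5 := card_sdiff_add_card_eq_card (hKU u)
        have h6 := hActK u hu
        have h7 : 2 * #(K Q u) ≤ 2 * k * #(K Q u) := Nat.mul_le_mul_right _ (by omega)
        have h8 : 4 * #(K Q u) ≤ 2 * k * #(K Q u) := Nat.mul_le_mul_right _ (by omega)
        omega
      nlinarith [Nat.mul_le_mul_right M h4]
    have h3 := card_nsmul_le_sum Act _ _ h1
    rw [smul_eq_mul, ← mul_sum] at h3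
    nlinarith [Nat.mul_le_mul_right (M * M) hActM]
  obtain ⟨v, hv⟩ : ∃ v, M * M ≤ 8 * k ^ 2 * ∑ u ∈ Act, gain v u := by
    by_contra hcon
    push Not at hcon
    have h1 : ∑ v, A v * (8 * k ^ 2 * ∑ u ∈ Act, gain v u + 1) ≤ ∑ v, A v * (M * M) :=
      sum_le_sum fun v _ => Nat.mul_le_mul_left _ (hcon v)
    have h3 : ∑ v, A v * (8 * k ^ 2 * ∑ u ∈ Act, gain v u + 1)
        = k ^ 2 * (8 * ∑ v, A v * ∑ u ∈ Act, gain v u) + ∑ v, A v := by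
      simp_rw [mul_add, sum_add_distrib, mul_one, mul_sum]
      congr 1
      exact sum_congr rfl fun v _ => sum_congr rfl fun u _ => by ring
    rw [h3, ← sum_mul] at h1
    have h4 := Nat.mul_le_mul_left (k ^ 2) havg
    have h5 := Nat.mul_le_mul_right (M * M) htotal
    have h6 : 0 < ∑ v, A v := by
      obtain ⟨u, hu⟩ := hne
      have := hweight u hu u hu
      have h7 : ∑ v with Good u u v, A v ≤ ∑ v, A v :=
        sum_le_sum_of_subset (filter_subset _ _)
      omega
    nlinarith
  have hinc : f Q + 2 * k * ∑ u ∈ Act, gain v u ≤ f (Q ∪ {v}) := by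
    have h1 : ∀ u ∈ U, min (2 * k * #(K Q u)) (3 * M) + (if u ∈ Act then 2 * k * gain v u else 0)
        ≤ min (2 * k * #(K (Q ∪ {v}) u)) (3 * M) := by
      intro u hu
      have hmono : K Q u ⊆ K (Q ∪ {v}) u := by
        intro p hp
        simp only [hK, mem_filter] at hp ⊢
        obtain ⟨hpU, x, hx, hxg⟩ := hp
        exact ⟨hpU, x, mem_union_left _ hx, hxg⟩
      split_ifs with hact
      · have hun : #(K Q u) + gain v u ≤ #(K (Q ∪ {v}) u) := by
          rw [hgain, ← card_union_of_disjoint]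
          · refine card_le_card (union_subset hmono ?_)
            intro p hp
            simp only [hK, mem_filter, mem_sdiff] at hp ⊢
            exact ⟨hp.1.1, v, by simp, hp.2⟩
          · refine disjoint_left.mpr fun p hp hp' => ?_
            exact (mem_sdiff.mp (mem_filter.mp hp').1).2 hp
        have hg : k * gain v u ≤ M := by
          by_cases hva : φ v = a
          · have : gain v u = 0 := by
              simp only [hgain, card_eq_zero, filter_eq_empty_iff]
              exact fun p _ hp => hp.1 hva
            simp [this]
          · refine le_trans (Nat.mul_le_mul_left _ (card_le_card ?_)) (hpair v hva u hu).le
            intro p hp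
            simp only [mem_filter, mem_sdiff] at hp ⊢
            exact ⟨hp.1.1, hp.2.2⟩
        have h3 := hActK u hact
        have h4 : 2 * k * #(K Q u) + 2 * k * gain v u ≤ 2 * k * #(K (Q ∪ {v}) u) := by
          rw [← mul_add]; exact Nat.mul_le_mul_left _ hun
        have h5 : 2 * k * gain v u = 2 * (k * gain v u) := by ring
        rw [min_eq_left (by omega)]
        exact le_min h4 (by omega)
      · rw [add_zero]
        exact min_le_min_right _ (Nat.mul_le_mul_left _ (card_le_card hmono))
    have h3 := sum_le_sum h1
    rw [sum_add_distrib, ← sum_filter] at h3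
    have h4 : U.filter (fun u => u ∈ Act) = Act := by
      ext u
      simp only [mem_filter]
      exact ⟨fun h => h.2, fun h => ⟨hActU u h, h⟩⟩
    rw [h4, ← mul_sum] at h3
    exact h3
  refine ⟨{v}, ?_, ?_⟩
  · have : 0 < 2 * k * ∑ u ∈ Act, gain v u := by
      have h1 : 0 < M * M := Nat.mul_pos hMpos hMpos
      rcases Nat.eq_zero_or_pos (∑ u ∈ Act, gain v u) with h0 | h0
      · rw [h0] at hv; omega
      · exact Nat.mul_pos (by omega) h0
    omega
  · rw [card_singleton, one_mul]
    have h1 := Nat.mul_le_mul_left (4 * k) hinc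
    nlinarith

/-- If each of many vertices `u` (the set `I`) has a set `K u ⊆ U` of size at least `#U / (2 k)`,
then few elements of `U` suffice to hit a quarter of these sets. -/
lemma exists_hitting_set {k : ℕ} {U I : Finset V} {K : V → Finset V} (hK : ∀ u, K u ⊆ U)
    (hpos : 0 < #U) (hI : #U < 2 * #I) (hKI : ∀ u ∈ I, #U ≤ 2 * k * #(K u)) :
    ∃ P : Finset V, #U ≤ 4 * #{u ∈ I | ∃ p ∈ P, p ∈ K u} ∧
      #P * #U ≤ 8 * k * #{u ∈ I | ∃ p ∈ P, p ∈ K u} := by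
  refine exists_of_potential (f := fun P => #{u ∈ I | ∃ p ∈ P, p ∈ K u}) (F := #I)
    (A := #U) (B := 8 * k) (fun Q => card_filter_le _ _)
    (Done := fun P => #U ≤ 4 * #{u ∈ I | ∃ p ∈ P, p ∈ K u}) ?_
  intro P hs
  -- The vertices whose sets are not hit yet.
  set J : Finset V := {u ∈ I | ¬ ∃ p ∈ P, p ∈ K u} with hJ
  have hJI : J ⊆ I := filter_subset _ _
  have hJc : #U ≤ 4 * #J := by
    have h1 : #{u ∈ I | ∃ p ∈ P, p ∈ K u} + #J = #I := by
      convert card_filter_add_card_filter_not (s := I) (fun u => ∃ p ∈ P, p ∈ K u)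
    omega
  obtain ⟨p, hp⟩ : ∃ p, #U ≤ 8 * k * #{u ∈ J | p ∈ K u} := by
    by_contra hcon
    push Not at hcon
    have h1 : ∑ p ∈ U, 8 * k * #{u ∈ J | p ∈ K u} < ∑ _p ∈ U, #U :=
      sum_lt_sum_of_nonempty (card_pos.mp hpos) fun p _ => hcon p
    have h3 : ∑ p ∈ U, #{u ∈ J | p ∈ K u} = ∑ u ∈ J, #(K u) := by
      simp_rw [card_eq_sum_ones, sum_filter]
      rw [sum_comm]
      refine sum_congr rfl fun u _ => ?_
      rw [← sum_filter]
      congr 1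
      ext q
      simp only [mem_filter]
      exact ⟨fun h => h.2, fun h => ⟨hK u h, h⟩⟩
    rw [← mul_sum, h3, sum_const, smul_eq_mul] at h1
    have h4 : #J * #U ≤ ∑ u ∈ J, 2 * k * #(K u) := by
      rw [← smul_eq_mul]
      exact card_nsmul_le_sum _ _ _ fun u hu => hKI u (hJI hu)
    rw [← mul_sum] at h4
    nlinarith [Nat.mul_le_mul_right #U hJc]
  have hinc : #{u ∈ I | ∃ p ∈ P, p ∈ K u} + #{u ∈ J | p ∈ K u}
      ≤ #{u ∈ I | ∃ q ∈ P ∪ {p}, q ∈ K u} := by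
    rw [← card_union_of_disjoint]
    · refine card_le_card (union_subset ?_ ?_)
      · intro u hu
        simp only [mem_filter] at hu ⊢
        obtain ⟨h1, q, hq, hqu⟩ := hu
        exact ⟨h1, q, mem_union_left _ hq, hqu⟩
      · intro u hu
        simp only [mem_filter] at hu ⊢
        exact ⟨hJI hu.1, p, by simp, hu.2⟩
    · refine disjoint_left.mpr fun u hu hu' => ?_
      exact (mem_filter.mp (mem_filter.mp hu').1).2 (mem_filter.mp hu).2
  refine ⟨{p}, ?_, ?_⟩
  · have : 0 < #{u ∈ J | p ∈ K u} := by
      rcases Nat.eq_zero_or_pos #{u ∈ J | p ∈ K u} with h0 | h0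
      · rw [h0] at hp; omega
      · exact h0
    show #{u ∈ I | ∃ q ∈ P, q ∈ K u} < _
    omega
  · rw [card_singleton, one_mul]
    have h1 := Nat.mul_le_mul_left (8 * k) hinc
    rw [mul_add] at h1
    show _ + 8 * k * #{u ∈ I | ∃ q ∈ P, q ∈ K u} ≤ _
    omega

/-- A monochromatic set `U` can be revealed at the rate of one seed vertex per `#U / (56 k)`
vertices of `U`, where `k ^ 3` bounds the number of vertices. -/
lemma exists_seed_of_monochromatic (hφ : ∀ u v, G.Adj u v → φ u ≠ φ v)
    (h2 : ∀ u v, ¬ G.Adj u v → ∃ w, G.Adj u w ∧ G.Adj w v) {k : ℕ} (hk : 2 ≤ k)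
    (hn : Fintype.card V ≤ k ^ 3) {U : Finset V} {a : κ} (hU : ∀ u ∈ U, φ u = a)
    (hne : U.Nonempty) :
    ∃ R : Finset V, 0 < #{u ∈ U | ∃ w, G.Adj u w ∧ Forced G φ R w} ∧
      #R * #U ≤ 56 * k * #{u ∈ U | ∃ w, G.Adj u w ∧ Forced G φ R w} := by
  have hpos : 0 < #U := card_pos.mpr hne
  have hfin : ∀ (R : Finset V) (c : ℕ), #U ≤ c → #R * #U ≤ 56 * c →
      c ≤ k * #{u ∈ U | ∃ w, G.Adj u w ∧ Forced G φ R w} →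
      0 < #{u ∈ U | ∃ w, G.Adj u w ∧ Forced G φ R w} ∧
      #R * #U ≤ 56 * k * #{u ∈ U | ∃ w, G.Adj u w ∧ Forced G φ R w} := by
    intro R c h1 h3 h4
    constructor
    · rcases Nat.eq_zero_or_pos #{u ∈ U | ∃ w, G.Adj u w ∧ Forced G φ R w} with h0 | h0
      · rw [h0] at h4; omega
      · exact h0
    · rw [mul_assoc]; omega
  by_cases hdeg : ∃ v, #U ≤ k * #{u ∈ U | G.Adj v u}
  · obtain ⟨v, hv⟩ := hdeg
    refine ⟨{v}, hfin _ _ hv (by rw [card_singleton]; omega)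
      (Nat.mul_le_mul_left _ (card_le_card ?_))⟩
    intro u hu
    rw [mem_filter] at hu ⊢
    exact ⟨hu.1, v, hu.2.symm, Or.inl (by simp)⟩
  by_cases hpair : ∃ v, φ v ≠ a ∧ ∃ u ∈ U,
      #U ≤ k * #{p ∈ U | ∃ w, G.Adj u w ∧ G.Adj p w ∧ G.Adj v w}
  · obtain ⟨v, hva, u, hu, hv⟩ := hpair
    refine ⟨{v, u}, hfin _ _ hv ?_ (Nat.mul_le_mul_left _ (card_le_card ?_))⟩
    · have := Nat.mul_le_mul_right #U (card_le_two (a := v) (b := u))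
      omega
    · intro p hp
      rw [mem_filter] at hp ⊢
      obtain ⟨hpU, w, hw1, hw2, hw3⟩ := hp
      exact ⟨hpU, w, hw2, Or.inr ⟨v, by simp, u, by simp, hw3.symm, hw1.symm,
        fun h => hva (h.trans (hU u hu))⟩⟩
  push Not at hdeg hpair
  obtain ⟨Q, hQ, hQI⟩ := exists_connecting_set hφ h2 hk hn hU hne hdeg hpair
  obtain ⟨P, hP1, hP2⟩ := exists_hitting_set (k := k) (U := U)
    (K := fun u => {p ∈ U | ∃ v ∈ Q, φ v ≠ a ∧ ∃ w, G.Adj u w ∧ G.Adj p w ∧ G.Adj v w})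
    (fun u => filter_subset _ _) hpos hQI (fun u hu => (mem_filter.mp hu).2)
  have hle := card_le_card (show ({u ∈ ({u ∈ U | #U ≤ 2 * k * #{p ∈ U | ∃ v ∈ Q,
      φ v ≠ a ∧ ∃ w, G.Adj u w ∧ G.Adj p w ∧ G.Adj v w}} : Finset V) | ∃ p ∈ P,
        p ∈ ({p ∈ U | ∃ v ∈ Q, φ v ≠ a ∧ ∃ w, G.Adj u w ∧ G.Adj p w ∧ G.Adj v w} : Finset V)} :
      Finset V) ⊆ {u ∈ U | ∃ w, G.Adj u w ∧ Forced G φ (Q ∪ P) w} by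
    intro u hu
    simp only [mem_filter] at hu ⊢
    obtain ⟨⟨huU, -⟩, p, hpP, hpU, v, hvQ, hva, w, hw1, hw2, hw3⟩ := hu
    exact ⟨huU, w, hw1, Or.inr ⟨v, mem_union_left _ hvQ, p, mem_union_right _ hpP, hw3.symm,
      hw2.symm, fun h => hva (h.trans (hU p hpU))⟩⟩)
  refine ⟨Q ∪ P, by omega, ?_⟩
  have h1 : #(Q ∪ P) * #U ≤ (#Q + #P) * #U := Nat.mul_le_mul_right _ (card_union_le _ _)
  have h3 := Nat.mul_le_mul_right #U hQ
  have h4 := Nat.mul_le_mul_left (8 * k) hle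
  have h5 := Nat.mul_le_mul_left (12 * k) (hP1.trans (Nat.mul_le_mul_left 4 hle))
  rw [add_mul] at h1
  nlinarith

end Seeds

/-- At most `336 k` additional seed vertices halve the number of hidden vertices: as long as more
than half of them remain hidden, the largest color class among them is revealed further. -/
lemma exists_halving_seed {V : Type*} [Fintype V] {G : SimpleGraph V} {φ : V → Fin 3}
    (hφ : ∀ u v, G.Adj u v → φ u ≠ φ v)
    (h2 : ∀ u v, ¬ G.Adj u v → ∃ w, G.Adj u w ∧ G.Adj w v) {k : ℕ} (hk : 2 ≤ k)
    (hn : Fintype.card V ≤ k ^ 3) (S : Finset V) :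
    ∃ R : Finset V, #R ≤ 336 * k ∧ 2 * #(hidden G φ (S ∪ R)) ≤ #(hidden G φ S) := by
  set m := #(hidden G φ S) with hm
  rcases Nat.eq_zero_or_pos m with h0 | hpos
  · exact ⟨∅, by simp, by rw [union_empty, ← hm, h0]⟩
  have hdone := exists_of_potential (f := fun Q => m - #(hidden G φ (S ∪ Q)))
    (F := m) (A := m) (B := 336 * k) (fun Q => Nat.sub_le _ _)
    (Done := fun Q => 2 * #(hidden G φ (S ∪ Q)) ≤ m) ?_
  · obtain ⟨Q, hs, hQ⟩ := hdone
    refine ⟨Q, ?_, hs⟩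
    exact Nat.le_of_mul_le_mul_right (hQ.trans (Nat.mul_le_mul_left _ (Nat.sub_le _ _))) hpos
  intro Q hs
  set X := hidden G φ (S ∪ Q) with hX
  -- The most frequent color on the hidden set.
  obtain ⟨a, ha⟩ : ∃ a : Fin 3, #X ≤ 3 * #{u ∈ X | φ u = a} := by
    by_contra hcon
    push Not at hcon
    have h1 := card_eq_sum_card_fiberwise (s := X) (t := univ) (f := φ) fun _ _ => mem_univ _
    rw [Fin.sum_univ_three] at h1
    have := hcon 0
    have := hcon 1
    have := hcon 2
    omega
  have hne : ({u ∈ X | φ u = a} : Finset V).Nonempty := card_pos.mp (by omega)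
  obtain ⟨R, hR1, hR2⟩ := exists_seed_of_monochromatic hφ h2 hk hn
    (fun u hu => (mem_filter.mp hu).2) hne
  set Cov : Finset V := {u ∈ ({u ∈ X | φ u = a} : Finset V) | ∃ w, G.Adj u w ∧ Forced G φ R w}
    with hCov
  have hdisj : #Cov + #(hidden G φ (S ∪ (Q ∪ R))) ≤ #X := by
    rw [← card_union_of_disjoint]
    · refine card_le_card (union_subset (fun u hu => (mem_filter.mp (mem_filter.mp hu).1).1) ?_)
      exact hidden_anti (union_subset_union_right subset_union_left)
    · refine disjoint_left.mpr fun u hu hu' => ?_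
      obtain ⟨w, hw, hf⟩ := (mem_filter.mp hu).2
      exact (mem_filter.mp hu').2 w hw (hf.mono (by
        intro x hx; simp [hx]))
  have hXm : #X ≤ m := card_le_card (hidden_anti subset_union_left)
  refine ⟨R, ?_, ?_⟩
  · show m - #X < m - #(hidden G φ (S ∪ (Q ∪ R)))
    omega
  · show _ + 336 * k * (m - #X) ≤ 336 * k * (m - #(hidden G φ (S ∪ (Q ∪ R))))
    have h1 : m - #X + #Cov ≤ m - #(hidden G φ (S ∪ (Q ∪ R))) := by omega
    have h3 := Nat.mul_le_mul_left (336 * k) h1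
    have h4 : #R * m ≤ #R * (6 * #{u ∈ X | φ u = a}) := Nat.mul_le_mul_left _ (by omega)
    nlinarith

/-- Every proper coloring has a seed of at most `336 k g` vertices that leaves no vertex hidden. -/
theorem exists_seed {V : Type*} [Fintype V] {G : SimpleGraph V} {φ : V → Fin 3}
    (hφ : ∀ u v, G.Adj u v → φ u ≠ φ v)
    (h2 : ∀ u v, ¬ G.Adj u v → ∃ w, G.Adj u w ∧ G.Adj w v) {k g : ℕ} (hk : 2 ≤ k)
    (hn : Fintype.card V ≤ k ^ 3) (hg : Fintype.card V < 2 ^ g) :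
    ∃ S : Finset V, #S ≤ 336 * k * g ∧ hidden G φ S = ∅ := by
  have key : ∀ j : ℕ, ∃ S : Finset V, #S ≤ 336 * k * j ∧
      #(hidden G φ S) * 2 ^ j ≤ Fintype.card V := by
    intro j
    induction j with
    | zero => exact ⟨∅, by simp, by simpa using card_le_univ _⟩
    | succ j ih =>
      obtain ⟨S, h1, h3⟩ := ih
      obtain ⟨R, h4, h5⟩ := exists_halving_seed hφ h2 hk hn S
      refine ⟨S ∪ R, (card_union_le _ _).trans (by rw [mul_add]; omega), ?_⟩
      calc #(hidden G φ (S ∪ R)) * 2 ^ (j + 1) = (2 * #(hidden G φ (S ∪ R))) * 2 ^ j := by ring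
        _ ≤ #(hidden G φ S) * 2 ^ j := Nat.mul_le_mul_right _ h5
        _ ≤ _ := h3
  obtain ⟨S, h1, h3⟩ := key g
  refine ⟨S, h1, ?_⟩
  by_contra hne
  have h4 : 0 < #(hidden G φ S) := card_pos.mpr (nonempty_iff_ne_empty.mpr hne)
  have := Nat.mul_le_mul_right (2 ^ g) h4
  omega

/-- In a graph of diameter `2`, any two nonadjacent vertices, equal or not, have a common
neighbor. -/
lemma exists_common_neighbor_of_diam_eq_two {V : Type*} {G : SimpleGraph V} (h : G.diam = 2)
    (u v : V) (huv : ¬ G.Adj u v) : ∃ w, G.Adj u w ∧ G.Adj w v := by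
  have h0 : G.diam ≠ 0 := by omega
  have htop := SimpleGraph.ediam_ne_top_of_diam_ne_zero h0
  have : Nontrivial V := SimpleGraph.nontrivial_of_diam_ne_zero h0
  have hconn : G.Connected := by
    by_contra hc
    exact htop (SimpleGraph.ediam_eq_top_of_not_connected hc)
  by_cases hne : u = v
  · subst hne
    obtain ⟨w, hw⟩ := hconn.preconnected.exists_adj_of_nontrivial u
    exact ⟨w, hw, hw.symm⟩
  · have hd : G.dist u v ≤ 2 := h ▸ SimpleGraph.dist_le_diam htop
    obtain ⟨p, hp⟩ := hconn.exists_walk_length_eq_dist u v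
    rw [← hp] at hd
    match p, hd with
    | .nil, _ => exact absurd rfl hne
    | .cons h1 .nil, _ => exact absurd h1 huv
    | .cons h1 (.cons h3 .nil), _ => exact ⟨_, h1, h3⟩
    | .cons _ (.cons _ (.cons _ _)), hd => simp at hd

lemma three_le_of_diam_eq_two {n : ℕ} {G : SimpleGraph (Fin n)} (h : G.diam = 2) : 3 ≤ n := by
  by_contra hn
  have : Nontrivial (Fin n) := SimpleGraph.nontrivial_of_diam_ne_zero (G := G) (by omega)
  obtain rfl : n = 2 := by
    have := Fin.nontrivial_iff_two_le.mp this
    omega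
  obtain ⟨x, hx, -⟩ := exists_common_neighbor_of_diam_eq_two h 0 0 (G.irrefl)
  have h01 : G.Adj 0 1 := by
    fin_cases x
    · exact absurd hx G.irrefl
    · exact hx
  have htop : G = ⊤ := by
    ext a b
    fin_cases a <;> fin_cases b <;> simp [h01, h01.symm]
  rw [htop, SimpleGraph.diam_top] at h
  omega

end ListThreeColoring

/-! ### Propagation of lists -/

namespace ListThreeColoring

section Propagation

variable {V : Type*} {G : SimpleGraph V}

/-- `Propagates G W W'`: the lists `W'` arise from `W` by repeatedly removing a color `c` from the
list of a neighbor of a vertex whose list contains no color other than `c`. -/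
inductive Propagates [DecidableEq V] (G : SimpleGraph V) (W : V → Finset (Fin 3)) :
    (V → Finset (Fin 3)) → Prop
  | refl : Propagates G W W
  | erase {W' : V → Finset (Fin 3)} {u v : V} {c : Fin 3} : Propagates G W W' → G.Adj u v →
      W' u ⊆ {c} → Propagates G W (Function.update W' v ((W' v).erase c))

/-- The lists `W` admit no further propagation. -/
def Closed (G : SimpleGraph V) (W : V → Finset (Fin 3)) : Prop :=
  ∀ u v c, G.Adj u v → W u ⊆ {c} → c ∉ W v

/-- `ψ` is a proper coloring of `G` from the lists `W`. -/
def Respects (G : SimpleGraph V) (W : V → Finset (Fin 3)) (ψ : V → Fin 3) : Prop :=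
  (∀ u v, G.Adj u v → ψ u ≠ ψ v) ∧ ∀ v, ψ v ∈ W v

lemma update_erase_subset [DecidableEq V] (W : V → Finset (Fin 3)) (v x : V) (c : Fin 3) :
    Function.update W v ((W v).erase c) x ⊆ W x := by
  by_cases h : x = v
  · subst h; simpa using Finset.erase_subset _ _
  · simp [h]

namespace Propagates

variable [DecidableEq V] {W W' W'' : V → Finset (Fin 3)}

lemma trans (h : Propagates G W W') (h' : Propagates G W' W'') : Propagates G W W'' := by
  induction h' with
  | refl => exact h
  | erase _ hadj hc ih => exact ih.erase hadj hc

lemma subset (h : Propagates G W W') (v : V) : W' v ⊆ W v := by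
  induction h with
  | refl => exact subset_rfl
  | erase _ _ _ ih => exact (update_erase_subset _ _ _ _).trans ih

lemma respects (h : Propagates G W W') {ψ : V → Fin 3} (hψ : Respects G W ψ) :
    Respects G W' ψ := by
  induction h with
  | refl => exact hψ
  | @erase W' u v c _ hadj hc ih =>
    refine ⟨ih.1, fun x => ?_⟩
    by_cases h : x = v
    · subst h
      have hu := Finset.mem_singleton.mp (hc (ih.2 u))
      simpa using ⟨fun h => ih.1 u x hadj (hu.trans h.symm), ih.2 x⟩
    · simpa [h] using ih.2 x

lemma eq_of_closed (h : Propagates G W W') (hW : Closed G W) : W' = W := by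
  induction h with
  | refl => rfl
  | @erase W' u v c _ hadj hc ih =>
    subst ih
    rw [Finset.erase_eq_of_notMem (hW u v c hadj hc), Function.update_eq_self]

end Propagates

/-- If a coloring `φ` has a seed `S` leaving no vertex hidden, then fixing `φ` on `S` and
propagating reduces every list to at most two colors: every vertex has a neighbor whose color is
forced, and this color disappears from its list. -/
lemma card_le_two_of_hidden_eq_empty [Fintype V] {W : V → Finset (Fin 3)} (hW : Closed G W)
    {φ : V → Fin 3} (hφ : Respects G W φ) {S : Finset V} (hS : ∀ v ∈ S, W v ⊆ {φ v})
    (hh : hidden G φ S = ∅) (u : V) : (W u).card ≤ 2 := by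
  have hu : u ∉ hidden G φ S := by rw [hh]; simp
  simp only [hidden, Finset.mem_filter, Finset.mem_univ, true_and, not_forall, not_not] at hu
  obtain ⟨w, huw, hf⟩ := hu
  have hw : W w ⊆ {φ w} := by
    rcases hf with hw | ⟨p, hp, q, hq, hwp, hwq, hpq⟩
    · exact hS w hw
    · intro c hc
      have h1 : c ≠ φ p := fun h => hW p w (φ p) hwp.symm (hS p hp) (h ▸ hc)
      have h2 : c ≠ φ q := fun h => hW q w (φ q) hwq.symm (hS q hq) (h ▸ hc)
      have h3 := hφ.1 w p hwp
      have h4 := hφ.1 w q hwq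
      rw [Finset.mem_singleton]
      have key : ∀ a b c d : Fin 3, a ≠ b → c ≠ a → c ≠ b → d ≠ a → d ≠ b → c = d := by decide
      exact key _ _ _ _ hpq h1 h2 h3 h4
  have h1 : φ w ∉ W u := hW w u _ huw.symm hw
  have h2 : W u ⊆ Finset.univ.erase (φ w) := fun c hc =>
    Finset.mem_erase.mpr ⟨fun h => h1 (h ▸ hc), Finset.mem_univ _⟩
  exact (Finset.card_le_card h2).trans (by simp)

/-- Solvability survives the restriction of a list of size at most two: if propagation from
sublists `W'` of lists `W` of size at most two ends without an empty list, then a coloring from `W`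
may be recolored at the vertices with singleton lists. -/
lemma exists_respects_of_closed {W W' : V → Finset (Fin 3)} (hcard : ∀ v, (W v).card ≤ 2)
    {ψ : V → Fin 3} (hψ : Respects G W ψ) (hsub : ∀ v, W' v ⊆ W v) (hcl : Closed G W')
    (hne : ∀ v, W' v ≠ ∅) : ∃ ψ', Respects G W' ψ' := by
  have hdich : ∀ v, (∃ c, W' v = {c}) ∨ ψ v ∈ W' v := by
    intro v
    by_cases h : (W' v).card ≤ 1
    · left
      have := Finset.card_pos.mpr (Finset.nonempty_iff_ne_empty.mpr (hne v))
      exact Finset.card_eq_one.mp (by omega)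
    · right
      have := hcard v
      rw [Finset.eq_of_subset_of_card_le (hsub v) (by omega)]
      exact hψ.2 v
  have hch : ∀ v, ∃ d ∈ W' v, W' v = {d} ∨ d = ψ v := by
    intro v
    rcases hdich v with ⟨c, hc⟩ | h
    · exact ⟨c, by rw [hc]; simp, Or.inl hc⟩
    · exact ⟨_, h, Or.inr rfl⟩
  choose ψ' hmem hψ' using hch
  refine ⟨ψ', fun u v huv heq => ?_, hmem⟩
  rcases hψ' u with hu | hu
  · exact hcl u v (ψ' u) huv hu.subset (heq ▸ hmem v)
  rcases hψ' v with hv | hv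
  · exact hcl v u (ψ' v) huv.symm hv.subset (heq ▸ hmem u)
  · exact hψ.1 u v huv (by rw [← hu, ← hv, heq])

end Propagation

end ListThreeColoring

/-! ### Programs with bounded loops -/

namespace RAM

/-- Programs whose only loops are counting loops.  The loop `loop i b p` runs `p` with the first
cell of array `i` counting from `0` up to the value of the first cell of array `b`, exclusively. -/
inductive Cmd : Type
  | skip
  | write (a : ℕ) (i e : Expr)
  | seq (p q : Cmd)
  | ite (e : Expr) (p q : Cmd)
  | loop (i b : ℕ) (p : Cmd)

/-- Arrays with a single relevant cell serve as scalar variables. -/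
abbrev Expr.var (a : ℕ) : Expr := .read a (.const 0)

namespace Cmd

infixr:60 " ;; " => Cmd.seq

/-- Assignment to a scalar variable. -/
abbrev assign (a : ℕ) (e : Expr) : Cmd := .write a (.const 0) e

/-- The translation into programs. -/
def toProgram : Cmd → Program
  | skip => .skip
  | write a i e => .write a i e
  | seq p q => .seq p.toProgram q.toProgram
  | ite e p q => .ite e p.toProgram q.toProgram
  | loop i b p => .seq (.write i (.const 0) (.const 0))
      (.while (.sub (.var b) (.var i))
        (.seq p.toProgram (.write i (.const 0) (.add (.var i) (.const 1)))))

/-- The final memory state, provided that no loop body changes the counter or the bound of its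
loop. -/
def run : Cmd → State → State
  | skip, s => s
  | write a i e, s => s.set a (i.eval s) (e.eval s)
  | seq p q, s => q.run (p.run s)
  | ite e p q, s => if e.eval s ≠ 0 then p.run s else q.run s
  | loop i b p, s => (fun s => (p.run s).set i 0 ((p.run s) i 0 + 1))^[s b 0] (s.set i 0 0)

/-- The arrays a program writes to. -/
def writes : Cmd → List ℕ
  | skip => []
  | write a _ _ => [a]
  | seq p q => p.writes ++ q.writes
  | ite _ p q => p.writes ++ q.writes
  | loop i _ p => i :: p.writes

/-- The nesting depth of the loops. -/
def depth : Cmd → ℕ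
  | skip => 0
  | write _ _ _ => 0
  | seq p q => max p.depth q.depth
  | ite _ p q => max p.depth q.depth
  | loop _ _ p => p.depth + 1

/-- The number of steps, up to the number of repetitions of the loops. -/
def size : Cmd → ℕ
  | skip => 1
  | write _ i e => i.cost + e.cost + 1
  | seq p q => p.size + q.size
  | ite e p q => e.cost + 1 + p.size + q.size
  | loop _ _ p => p.size + 15

/-- All loop bounds are among the arrays `B`, no array in `B` is written to, and no loop body writes
to the counter of its loop. -/
def Ok (B : List ℕ) : Cmd → Bool
  | skip => true
  | write a _ _ => a ∉ B
  | seq p q => p.Ok B && q.Ok B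
  | ite _ p q => p.Ok B && q.Ok B
  | loop i b p => b ∈ B && i ∉ B && i ∉ p.writes && p.Ok B

end Cmd

lemma State.set_of_ne (s : State) {a a' : ℕ} (i x : ℕ) (h : a' ≠ a) : s.set a i x a' = s a' := by
  simp [State.set, h]

@[simp] lemma State.set_self (s : State) (a i x : ℕ) : s.set a i x a i = x := by
  simp [State.set]

lemma State.set_apply (s : State) (a i x a' i' : ℕ) :
    s.set a i x a' i' = if a' = a ∧ i' = i then x else s a' i' := by
  by_cases h : a' = a
  · subst h
    by_cases h' : i' = i
    · subst h'; simp [State.set]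
    · simp [State.set, h']
  · simp [State.set, h]

namespace Cmd

lemma run_of_notMem_writes (p : Cmd) (s : State) {a : ℕ} (h : a ∉ p.writes) :
    p.run s a = s a := by
  induction p generalizing s with
  | skip => rfl
  | write a' i e => exact State.set_of_ne _ _ _ (by simpa [writes] using h)
  | seq p q ihp ihq =>
    simp only [writes, List.mem_append, not_or] at h
    rw [run, ihq _ h.2, ihp _ h.1]
  | ite e p q ihp ihq =>
    simp only [writes, List.mem_append, not_or] at h
    rw [run]
    split_ifs
    · exact ihp _ h.1
    · exact ihq _ h.2
  | loop i b p ih =>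
    simp only [writes, List.mem_cons, not_or] at h
    rw [run]
    generalize s b 0 = m
    induction m with
    | zero => exact State.set_of_ne _ _ _ h.1
    | succ m ihm => rw [Function.iterate_succ_apply', State.set_of_ne _ _ _ h.1, ih _ h.2, ihm]

lemma notMem_writes_of_ok {B : List ℕ} {p : Cmd} (h : p.Ok B) {b : ℕ} (hb : b ∈ B) :
    b ∉ p.writes := by
  induction p with
  | skip => simp [writes]
  | write a i e =>
    simp only [Ok, decide_eq_true_eq] at h
    simp only [writes, List.mem_singleton]
    rintro rfl
    exact h hb
  | seq p q ihp ihq =>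
    simp only [Ok, Bool.and_eq_true] at h
    simp [writes, ihp h.1, ihq h.2]
  | ite e p q ihp ihq =>
    simp only [Ok, Bool.and_eq_true] at h
    simp [writes, ihp h.1, ihq h.2]
  | loop i b' p ih =>
    simp only [Ok, Bool.and_eq_true, decide_eq_true_eq] at h
    simp only [writes, List.mem_cons, not_or]
    refine ⟨?_, ih h.2⟩
    rintro rfl
    exact h.1.1.2 hb

/-- The reasoning rule for counting loops. -/
theorem run_loop_induct {i b : ℕ} {p : Cmd} (hi : i ∉ p.writes) (s : State)
    (I : ℕ → State → Prop) (h0 : I 0 (s.set i 0 0))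
    (hstep : ∀ k s', k < s b 0 → s' i 0 = k → (∀ a, a ∉ (loop i b p).writes → s' a = s a) →
      I k s' → I (k + 1) ((p.run s').set i 0 (k + 1))) :
    I (s b 0) ((loop i b p).run s) := by
  rw [run]
  have key : ∀ m, m ≤ s b 0 → ∀ s', s' = (fun s => (p.run s).set i 0 ((p.run s) i 0 + 1))^[m]
      (s.set i 0 0) → I m s' ∧ s' i 0 = m ∧ ∀ a, a ∉ (loop i b p).writes → s' a = s a := by
    intro m
    induction m with
    | zero =>
      rintro - s' rfl
      refine ⟨h0, by simp, fun a ha => ?_⟩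
      simp only [writes, List.mem_cons, not_or] at ha
      exact State.set_of_ne _ _ _ ha.1
    | succ m ih =>
      rintro hm s' rfl
      obtain ⟨h1, h2, h3⟩ := ih (by omega) _ rfl
      rw [Function.iterate_succ_apply']
      set s' := (fun s => (p.run s).set i 0 ((p.run s) i 0 + 1))^[m] (s.set i 0 0)
      have hval : (p.run s') i 0 = m := by rw [run_of_notMem_writes _ _ hi, h2]
      refine ⟨?_, ?_, fun a ha => ?_⟩
      · show I (m + 1) ((p.run s').set i 0 ((p.run s') i 0 + 1))
        rw [hval]
        exact hstep m s' (by omega) h2 h3 h1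
      · simp [hval]
      · have ha' := ha
        simp only [writes, List.mem_cons, not_or] at ha
        rw [State.set_of_ne _ _ _ ha.1, run_of_notMem_writes _ _ ha.2, h3 a ha']
  exact (key _ le_rfl _ rfl).1

/-- The running time is polynomial in a bound `M` for the numbers of repetitions of the loops. -/
theorem exec_toProgram {B : List ℕ} {p : Cmd} (h : p.Ok B) {M : ℕ} {s : State}
    (hM : ∀ b ∈ B, s b 0 ≤ M) :
    ∃ t, Exec p.toProgram s t (p.run s) ∧ t ≤ p.size * (M + 1) ^ p.depth := by
  induction p generalizing s with
  | skip => exact ⟨_, .skip s, by simp [size, depth]⟩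
  | write a i e => exact ⟨_, .write s a i e, by simp [size, depth]⟩
  | seq p q ihp ihq =>
    simp only [Ok, Bool.and_eq_true] at h
    obtain ⟨t, h1, h2⟩ := ihp h.1 hM
    obtain ⟨t', h3, h4⟩ := ihq h.2 (s := p.run s) fun b hb => by
      rw [run_of_notMem_writes _ _ (notMem_writes_of_ok h.1 hb)]; exact hM b hb
    refine ⟨_, h1.seq h3, ?_⟩
    have h5 : (M + 1) ^ p.depth ≤ (M + 1) ^ max p.depth q.depth :=
      Nat.pow_le_pow_right (by omega) (le_max_left _ _)
    have h6 : (M + 1) ^ q.depth ≤ (M + 1) ^ max p.depth q.depth :=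
      Nat.pow_le_pow_right (by omega) (le_max_right _ _)
    rw [size, depth, add_mul]
    exact add_le_add (h2.trans (Nat.mul_le_mul_left _ h5)) (h4.trans (Nat.mul_le_mul_left _ h6))
  | ite e p q ihp ihq =>
    simp only [Ok, Bool.and_eq_true] at h
    have h5 : (M + 1) ^ p.depth ≤ (M + 1) ^ max p.depth q.depth :=
      Nat.pow_le_pow_right (by omega) (le_max_left _ _)
    have h6 : (M + 1) ^ q.depth ≤ (M + 1) ^ max p.depth q.depth :=
      Nat.pow_le_pow_right (by omega) (le_max_right _ _)
    have h7 : 1 ≤ (M + 1) ^ max p.depth q.depth := Nat.one_le_pow _ _ (by omega)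
    have h8 := Nat.mul_le_mul_left (e.cost + 1) h7
    rw [size, depth, add_mul, add_mul, run]
    by_cases he : e.eval s = 0
    · obtain ⟨t, h1, h2⟩ := ihq h.2 hM
      rw [if_neg (not_not.mpr he)]
      refine ⟨_, .ite_false he h1, ?_⟩
      have := h2.trans (Nat.mul_le_mul_left _ h6)
      omega
    · obtain ⟨t, h1, h2⟩ := ihp h.1 hM
      rw [if_pos he]
      refine ⟨_, .ite_true he h1, ?_⟩
      have := h2.trans (Nat.mul_le_mul_left _ h5)
      omega
  | loop i b p ih =>
    simp only [Ok, Bool.and_eq_true, decide_eq_true_eq] at h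
    obtain ⟨⟨⟨hb, hiB⟩, hip⟩, hp⟩ := h
    have hBi : ∀ b ∈ B, b ≠ i := fun b hb h => hiB (h ▸ hb)
    set T := p.size * (M + 1) ^ p.depth with hT
    set step : State → State := fun s => (p.run s).set i 0 ((p.run s) i 0 + 1) with hstep
    -- A loop with `m` rounds left.
    have key : ∀ m s, (∀ b ∈ B, s b 0 ≤ M) → s b 0 = s i 0 + m →
        ∃ t, Exec (.while (.sub (.var b) (.var i))
          (.seq p.toProgram (.write i (.const 0) (.add (.var i) (.const 1))))) s t (step^[m] s) ∧
          t ≤ m * (T + 12) + 6 := by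
      intro m
      induction m with
      | zero =>
        intro s _ hs
        refine ⟨_, .while_false ?_, ?_⟩
        · simp [Expr.eval, hs]
        · simp [Expr.cost]
      | succ m ihm =>
        intro s hM hs
        obtain ⟨t, h1, h2⟩ := ih hp hM
        have hpb : ∀ b ∈ B, p.run s b = s b := fun b hb =>
          run_of_notMem_writes _ _ (notMem_writes_of_ok hp hb)
        have hpi : p.run s i = s i := run_of_notMem_writes _ _ hip
        have hne : ∀ b ∈ B, step s b = s b := fun b hb => by
          rw [hstep]
          show (p.run s).set i 0 _ b = _
          rw [State.set_of_ne _ _ _ (hBi b hb), hpb b hb]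
        obtain ⟨t', h3, h4⟩ := ihm (step s) (fun b hb => by rw [hne b hb]; exact hM b hb) (by
          rw [hne b hb, hs]
          simp only [hstep, State.set_self, hpi]
          omega)
        rw [Function.iterate_succ_apply]
        have hw := Exec.write (p.run s) i (.const 0) (.add (.var i) (.const 1))
        refine ⟨_, .while_true (by simp [Expr.eval, hs]) (h1.seq hw) h3, ?_⟩
        simp only [Expr.cost]
        rw [add_mul]
        omega
    obtain ⟨t, h1, h2⟩ := key (s b 0) (s.set i 0 0)
      (fun b hb => by
        rw [State.set_of_ne _ _ _ (hBi b hb)]; exact hM b hb)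
      (by rw [State.set_of_ne _ _ _ (hBi b hb)]; simp)
    refine ⟨_, (Exec.write s i (.const 0) (.const 0)).seq h1, ?_⟩
    have h3 := hM b hb
    have h4 : s b 0 * (T + 12) ≤ M * (T + 12) := Nat.mul_le_mul_right _ h3
    have h5 : 1 ≤ (M + 1) ^ p.depth := Nat.one_le_pow _ _ (by omega)
    have h6 := Nat.mul_le_mul_left 15 h5
    rw [size, depth, pow_succ]
    simp only [Expr.cost]
    have h7 : (p.size + 15) * ((M + 1) ^ p.depth * (M + 1))
        = M * (T + 15 * (M + 1) ^ p.depth) + (T + 15 * (M + 1) ^ p.depth) := by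
      rw [hT]; ring
    have h8 : M * (T + 12) ≤ M * (T + 15 * (M + 1) ^ p.depth) :=
      Nat.mul_le_mul_left _ (by omega)
    rw [h7]
    omega

end Cmd

end RAM

/-! ### The search program -/

namespace ListThreeColoring

namespace Algo

open RAM RAM.Cmd

/- The arrays of the program.  Arrays `0` to `4` are those of the input and the output; names that
start with `i` belong to loop counters. -/

abbrev aN : ℕ := 0
abbrev aAdj : ℕ := 1
abbrev aList : ℕ := 2
abbrev aFound : ℕ := 3
abbrev aOut : ℕ := 4
/-- The array of the current lists, in the format of the input. -/
abbrev aCur : ℕ := 5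
/-- The array of the saved lists. -/
abbrev aSave : ℕ := 6
/-- Cell `u` of this array holds `u * n`, the position of row `u` of the adjacency matrix. -/
abbrev aRow : ℕ := 7
abbrev aThree : ℕ := 8
/-- Holds `3 * n`, the number of pairs of a vertex and a color. -/
abbrev aPairs : ℕ := 9
/-- Holds the least `k` with `n ≤ k ^ 3`. -/
abbrev aRoot : ℕ := 10
/-- Holds the least `g` with `n < 2 ^ g`. -/
abbrev aLog : ℕ := 11
/-- Holds the length of the guessed seed. -/
abbrev aLen : ℕ := 12
/-- Holds the number of guesses. -/
abbrev aNum : ℕ := 13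
abbrev iGuess : ℕ := 14
abbrev iDigit : ℕ := 15
abbrev iV : ℕ := 16
abbrev iC : ℕ := 17
abbrev iD : ℕ := 18
abbrev iCopy : ℕ := 19
abbrev iSweep : ℕ := 20
abbrev iTail : ℕ := 21
abbrev iHead : ℕ := 22
abbrev iE : ℕ := 23
/-- Holds the part of the guess that is still to be decoded. -/
abbrev aCode : ℕ := 24
/-- Holds the quotient of a division. -/
abbrev aQuot : ℕ := 25
abbrev iDiv : ℕ := 26
/-- Tells whether an empty list has been found. -/
abbrev aBad : ℕ := 27
/-- Tells whether the coloring has passed all checks so far. -/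
abbrev aOk : ℕ := 28
abbrev aSquare : ℕ := 29
abbrev aCube : ℕ := 30
abbrev aPow : ℕ := 31
abbrev aAcc : ℕ := 32

/-- Three times a variable. -/
abbrev triple (v : ℕ) : Expr := .add (.var v) (.add (.var v) (.var v))

/-- The position of the pair of a vertex and a color, given as variables, in a list array. -/
abbrev pos (v c : ℕ) : Expr := .add (triple v) (.var c)

/-- An expression that vanishes exactly when `e` and `f` have the same value. -/
abbrev neq (e f : Expr) : Expr := .add (.sub e f) (.sub f e)

/-- The adjacency matrix at two variables. -/
abbrev adjE (u v : ℕ) : Expr := .read aAdj (.add (.read aRow (.var u)) (.var v))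

/-- The sum of the three cells of the current list of `u`. -/
abbrev listSum (u : ℕ) : Expr :=
  .add (.add (.read aCur (triple u)) (.read aCur (.add (triple u) (.const 1))))
    (.read aCur (.add (triple u) (.const 2)))

/-- Copy the lists from array `a` to array `b`. -/
def copyLists (a b : ℕ) : Cmd :=
  .loop iCopy aPairs (.write b (.var iCopy) (.read a (.var iCopy)))

/-- Remove all colors other than `iC` from the list of the vertex `iV`. -/
def restrict : Cmd :=
  .loop iD aThree (.ite (neq (.var iD) (.var iC)) (.write aCur (pos iV iD) (.const 0)) .skip)

/-- One pass over all edges that propagates the lists without a second color. -/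
def sweep : Cmd :=
  .loop iTail aN (.loop iHead aN (.ite (adjE iTail iHead)
    (.loop iE aThree (.ite (.sub (listSum iTail) (.read aCur (pos iTail iE))) .skip
      (.write aCur (pos iHead iE) (.const 0)))) .skip))

/-- Propagate the lists exhaustively. -/
def propagate : Cmd := .loop iSweep aPairs sweep

/-- Division of `aCode` by `aPairs` by repeated subtraction; the remainder is left in `aCode`. -/
def divide : Cmd :=
  assign aQuot (.const 0) ;;
  .loop iDiv aNum (.ite (.sub (.add (.var aCode) (.const 1)) (.var aPairs))
    (assign aCode (.sub (.var aCode) (.var aPairs)) ;;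
      assign aQuot (.add (.var aQuot) (.const 1))) .skip)

/-- Restrict the lists according to the base-`3 * n` digits of `aCode`. -/
def applyGuess : Cmd :=
  .loop iDigit aLen (divide ;;
    .loop iV aN (.loop iC aThree (.ite (neq (.var aCode) (pos iV iC)) .skip restrict)) ;;
    assign aCode (.var aQuot))

/-- Set `aBad` to `1` if some list is empty, and to `0` otherwise. -/
def findEmpty : Cmd :=
  assign aBad (.const 0) ;;
  .loop iTail aN (.ite (listSum iTail) .skip (assign aBad (.const 1)))

/-- Try the color `iC` at the vertex `iV`: keep the result of restriction and propagation if no list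
becomes empty, and otherwise only remove the color from the list. -/
def tryColor : Cmd :=
  copyLists aCur aSave ;; restrict ;; propagate ;; findEmpty ;;
    .ite (.var aBad) (copyLists aSave aCur ;; .write aCur (pos iV iC) (.const 0)) .skip

/-- Try all colors at all vertices, one after the other. -/
def greedy : Cmd := .loop iV aN (.loop iC aThree tryColor)

/-- Write the least color of each list to the output. -/
def readOff : Cmd :=
  .loop iV aN (.write aOut (.var iV)
    (.add (.sub (.const 1) (.read aCur (triple iV)))
      (.sub (.sub (.const 1) (.read aCur (triple iV)))
        (.read aCur (.add (triple iV) (.const 1))))))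

/-- Check whether the output is a solution. -/
def verify : Cmd :=
  assign aOk (.const 1) ;;
  .loop iV aN
    (.ite (.read aList (.add (triple iV) (.read aOut (.var iV)))) .skip (assign aOk (.const 0)) ;;
    .loop iTail aN (.ite (adjE iV iTail)
      (.ite (neq (.read aOut (.var iV)) (.read aOut (.var iTail))) .skip (assign aOk (.const 0)))
      .skip)) ;;
  assign aFound (.var aOk)

/-- The attempt with the guess `iGuess`. -/
def attempt : Cmd :=
  assign aCode (.var iGuess) ;; copyLists aList aCur ;; applyGuess ;; propagate ;; greedy ;;
    readOff ;; verify

/-- Make attempts with all guesses until one succeeds. -/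
def search : Cmd := .loop iGuess aNum (.ite (.var aFound) .skip attempt)

/-! ### Correctness of the search program -/

/-- The lists stored in an array. -/
def lists (n : ℕ) (A : ℕ → ℕ) (v : Fin n) : Finset (Fin 3) :=
  Finset.univ.filter fun c => A (3 * (v : ℕ) + (c : ℕ)) ≠ 0

lemma mem_lists {n : ℕ} {A : ℕ → ℕ} {v : Fin n} {c : Fin 3} :
    c ∈ lists n A v ↔ A (3 * (v : ℕ) + (c : ℕ)) ≠ 0 := by
  simp [lists]

lemma mem_lists_update {n : ℕ} {A : ℕ → ℕ} {v : Fin n} {c : Fin 3} {u : Fin n} {d : Fin 3} :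
    d ∈ lists n (Function.update A (3 * (v : ℕ) + (c : ℕ)) 0) u ↔
      d ∈ lists n A u ∧ (u = v → d ≠ c) := by
  rw [mem_lists, mem_lists]
  by_cases h : 3 * (u : ℕ) + (d : ℕ) = 3 * (v : ℕ) + (c : ℕ)
  · have h1 : u = v := Fin.ext (by omega)
    have h2 : d = c := Fin.ext (by omega)
    subst h1 h2
    simp
  · rw [Function.update_of_ne h]
    constructor
    · rintro h1
      refine ⟨h1, ?_⟩
      rintro rfl rfl
      exact h rfl
    · exact fun h1 => h1.1

lemma lists_congr {n : ℕ} {A A' : ℕ → ℕ} (h : ∀ j < 3 * n, A j = A' j) :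
    lists n A = lists n A' := by
  funext v
  ext c
  rw [mem_lists, mem_lists, h _ (by omega)]

lemma _root_.RAM.State.set_same (s : State) (a i x : ℕ) :
    s.set a i x a = Function.update (s a) i x := by
  simp [State.set]

/-- The memory state holds the input and the derived constants of the search. -/
structure Ready {n : ℕ} (G : SimpleGraph (Fin n)) (L : Fin n → Finset (Fin 3)) (len : ℕ)
    (s : State) : Prop where
  n_eq : s aN 0 = n
  adj_iff : ∀ u v : Fin n, s aAdj (s aRow u + v) ≠ 0 ↔ G.Adj u v
  list_eq : lists n (s aList) = L
  three_eq : s aThree 0 = 3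
  pairs_eq : s aPairs 0 = 3 * n
  len_eq : s aLen 0 = len
  num_eq : s aNum 0 = (3 * n) ^ len

variable {n : ℕ} {G : SimpleGraph (Fin n)} {L : Fin n → Finset (Fin 3)} {len : ℕ}

lemma Ready.congr {s s' : State} (h : Ready G L len s)
    (hs : ∀ a ∈ [aN, aAdj, aList, aRow, aThree, aPairs, aLen, aNum], s' a = s a) :
    Ready G L len s' where
  n_eq := by rw [hs aN (by decide)]; exact h.n_eq
  adj_iff := by rw [hs aAdj (by decide), hs aRow (by decide)]; exact h.adj_iff
  list_eq := by rw [hs aList (by decide)]; exact h.list_eq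
  three_eq := by rw [hs aThree (by decide)]; exact h.three_eq
  pairs_eq := by rw [hs aPairs (by decide)]; exact h.pairs_eq
  len_eq := by rw [hs aLen (by decide)]; exact h.len_eq
  num_eq := by rw [hs aNum (by decide)]; exact h.num_eq

lemma Ready.of_frame {s s' : State} (h : Ready G L len s) {p : Cmd}
    (hs : ∀ a, a ∉ p.writes → s' a = s a)
    (hp : ∀ a ∈ [aN, aAdj, aList, aRow, aThree, aPairs, aLen, aNum], a ∉ p.writes := by decide) :
    Ready G L len s' :=
  h.congr fun a ha => hs a (hp a ha)

lemma Ready.run {s : State} (h : Ready G L len s) {p : Cmd}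
    (hp : ∀ a ∈ [aN, aAdj, aList, aRow, aThree, aPairs, aLen, aNum], a ∉ p.writes := by decide) :
    Ready G L len (p.run s) :=
  h.congr fun a ha => run_of_notMem_writes _ _ (hp a ha)

lemma run_copyLists {a b : ℕ} (hab : a ≠ b) (ha : a ≠ iCopy) (hb : b ≠ iCopy) (s : State) {j : ℕ}
    (hj : j < s aPairs 0) : (copyLists a b).run s b j = s a j := by
  refine run_loop_induct (p := .write b (.var iCopy) (.read a (.var iCopy)))
    (by simpa [writes] using hb.symm) s
    (fun k s' => ∀ j < k, s' b j = s a j) (by simp) ?_ j hj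
  intro k s' _ hk hfr ih j hj
  have h1 := hfr a (by simp [writes, ha, hab])
  rw [State.set_of_ne _ _ _ hb, Cmd.run, State.set_apply]
  by_cases h : j = k
  · simp [Expr.eval, h, hk, h1]
  · simp only [Expr.eval, hk, h, and_false, if_false]
    exact ih j (by omega)

lemma lists_run_copyLists {a b : ℕ} (hab : a ≠ b) (ha : a ≠ iCopy) (hb : b ≠ iCopy) {s : State}
    (hs : Ready G L len s) : lists n ((copyLists a b).run s b) = lists n (s a) :=
  lists_congr fun j hj => run_copyLists hab ha hb s (by rw [hs.pairs_eq]; exact hj)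

lemma mem_lists_run_restrict {s : State} (hs : Ready G L len s) {v : Fin n} {c : Fin 3}
    (hv : s iV 0 = v) (hc : s iC 0 = c) (u : Fin n) (d : Fin 3) :
    d ∈ lists n (restrict.run s aCur) u ↔ d ∈ lists n (s aCur) u ∧ (u = v → d = c) := by
  have key := run_loop_induct (i := iD) (b := aThree)
    (p := .ite (neq (.var iD) (.var iC)) (.write aCur (pos iV iD) (.const 0)) .skip)
    (by decide) s (fun k s' => ∀ (u : Fin n) (d : Fin 3), d ∈ lists n (s' aCur) u ↔
      d ∈ lists n (s aCur) u ∧ (u = v → d = c ∨ k ≤ d)) ?_ ?_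
  · have h := key u d
    rw [hs.three_eq] at h
    rw [restrict, h]
    have := d.2
    simp [not_le.mpr this]
  · intro u d
    rw [State.set_of_ne _ _ _ (by decide)]
    simp
  · intro k s' hk hk' hfr ih u d
    rw [hs.three_eq] at hk
    have h1 := hfr iV (by decide)
    have h2 := hfr iC (by decide)
    rw [State.set_of_ne _ _ _ (by decide), Cmd.run]
    simp only [Expr.eval, hk', h2, hc]
    by_cases hkc : k = c
    · rw [if_neg (by omega), Cmd.run, ih]
      refine and_congr_right fun _ => imp_congr_right fun _ => ?_
      rw [Fin.ext_iff]
      omega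
    · rw [if_pos (by omega), Cmd.run, State.set_same]
      simp only [Expr.eval, hk', h1, hv]
      have := mem_lists_update (A := s' aCur) (v := v) (c := (⟨k, hk⟩ : Fin 3)) (u := u) (d := d)
      rw [show (v : ℕ) + (v + v) + k = 3 * (v : ℕ) + ((⟨k, hk⟩ : Fin 3) : ℕ) by simp; omega,
        this, ih]
      rw [and_assoc]
      refine and_congr_right fun _ => ?_
      rw [← imp_and]
      refine imp_congr_right fun _ => ?_
      rw [Fin.ext_iff, ne_eq, Fin.ext_iff]
      simp only
      omega

lemma eval_adjE_ne_zero {s : State} (hs : Ready G L len s) {a b : ℕ} {u v : Fin n}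
    (hu : s a 0 = u) (hv : s b 0 = v) : (adjE a b).eval s ≠ 0 ↔ G.Adj u v := by
  rw [← hs.adj_iff]
  simp [Expr.eval, hu, hv]

lemma eval_listSum_eq_zero {s : State} {a : ℕ} {u : Fin n} (hu : s a 0 = u) :
    (listSum a).eval s = 0 ↔ lists n (s aCur) u = ∅ := by
  simp only [Expr.eval, hu, Finset.eq_empty_iff_forall_notMem, mem_lists, not_not,
    Fin.forall_fin_succ, show (u : ℕ) + (u + u) = 3 * (u : ℕ) by omega]
  simp
  omega

lemma eval_other_eq_zero {s : State} {a b : ℕ} {u : Fin n} {c : Fin 3} (hu : s a 0 = u)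
    (hc : s b 0 = c) : (Expr.sub (listSum a) (.read aCur (pos a b))).eval s = 0 ↔
      lists n (s aCur) u ⊆ {c} := by
  have h : lists n (s aCur) u ⊆ {c} ↔ ∀ d : Fin 3, d ≠ c → s aCur (3 * (u : ℕ) + d) = 0 := by
    simp only [Finset.subset_iff, mem_lists, Finset.mem_singleton]
    exact forall_congr' fun d => by rw [not_imp_comm]
  rw [h]
  simp only [Expr.eval, hu, hc, show (u : ℕ) + (u + u) = 3 * (u : ℕ) by omega]
  clear h hc
  fin_cases c <;> simp [Fin.forall_fin_succ] <;> omega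

/-- A loop whose body propagates lists propagates lists; the effects of the single rounds persist
if they are inherited by smaller lists. -/
lemma run_loop_propagates {i b : ℕ} {p : Cmd} (hi : i ∉ p.writes) (hc : aCur ≠ i) (s : State)
    {Q : ℕ → (Fin n → Finset (Fin 3)) → Prop}
    (hQ : ∀ k W W', Propagates G W W' → Q k W → Q k W')
    (hbody : ∀ k s', k < s b 0 → s' i 0 = k → (∀ a, a ∉ (loop i b p).writes → s' a = s a) →
      Propagates G (lists n (s aCur)) (lists n (s' aCur)) →
      Propagates G (lists n (s' aCur)) (lists n (p.run s' aCur)) ∧ Q k (lists n (p.run s' aCur))) :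
    Propagates G (lists n (s aCur)) (lists n ((loop i b p).run s aCur)) ∧
      ∀ k < s b 0, Q k (lists n ((loop i b p).run s aCur)) := by
  refine run_loop_induct hi s (fun k s' => Propagates G (lists n (s aCur)) (lists n (s' aCur)) ∧
      ∀ j < k, Q j (lists n (s' aCur))) ?_ ?_
  · rw [State.set_of_ne _ _ _ hc]
    exact ⟨.refl, by simp⟩
  · intro k s' hk hk' hfr ih
    rw [State.set_of_ne _ _ _ hc]
    obtain ⟨h1, h2⟩ := hbody k s' hk hk' hfr ih.1
    refine ⟨ih.1.trans h1, fun j hj => ?_⟩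
    by_cases h : j = k
    · exact h ▸ h2
    · exact hQ _ _ _ h1 (ih.2 j (by omega))

lemma run_sweep {s : State} (hs : Ready G L len s) :
    Propagates G (lists n (s aCur)) (lists n (sweep.run s aCur)) ∧
      ∀ u v c, G.Adj u v → lists n (s aCur) u ⊆ {c} → c ∉ lists n (sweep.run s aCur) v := by
  have hmono : ∀ {P : Prop} {W W' : Fin n → Finset (Fin 3)} {v : Fin n} {c : Fin 3},
      Propagates G W W' → (P → c ∉ W v) → P → c ∉ W' v := fun h h1 hP hc => h1 hP (h.subset _ hc)
  have key := run_loop_propagates (G := G) (n := n) (i := iTail) (b := aN)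
    (p := .loop iHead aN (.ite (adjE iTail iHead)
      (.loop iE aThree (.ite (.sub (listSum iTail) (.read aCur (pos iTail iE))) .skip
        (.write aCur (pos iHead iE) (.const 0)))) .skip)) (by decide) (by decide) s
    (Q := fun k W => ∀ hk : k < n, ∀ (v : Fin n) c, G.Adj ⟨k, hk⟩ v →
      lists n (s aCur) ⟨k, hk⟩ ⊆ {c} → c ∉ W v)
    (fun k W W' h h1 hk v c hadj => hmono h (h1 hk v c hadj)) ?_
  · exact ⟨key.1, fun u v c => key.2 u (by rw [hs.n_eq]; exact u.2) u.2 v c⟩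
  intro k s₁ hk hk₁ hfr₁ hp₁
  rw [hs.n_eq] at hk
  have hs₁ := hs.of_frame hfr₁
  have key := run_loop_propagates (G := G) (n := n) (i := iHead) (b := aN)
    (p := .ite (adjE iTail iHead)
      (.loop iE aThree (.ite (.sub (listSum iTail) (.read aCur (pos iTail iE))) .skip
        (.write aCur (pos iHead iE) (.const 0)))) .skip) (by decide) (by decide) s₁
    (Q := fun j W => ∀ hj : j < n, ∀ c, G.Adj ⟨k, hk⟩ ⟨j, hj⟩ →
      lists n (s aCur) ⟨k, hk⟩ ⊆ {c} → c ∉ W ⟨j, hj⟩)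
    (fun j W W' h h1 hj c hadj => hmono h (h1 hj c hadj)) ?_
  · exact ⟨key.1, fun _ v c => key.2 v (by rw [hs₁.n_eq]; exact v.2) v.2 c⟩
  intro j s₂ hj hj₂ hfr₂ hp₂
  rw [hs₁.n_eq] at hj
  have hs₂ := hs₁.of_frame hfr₂
  have htail : s₂ iTail 0 = ((⟨k, hk⟩ : Fin n) : ℕ) := by rw [hfr₂ iTail (by decide), hk₁]
  have hadj := eval_adjE_ne_zero hs₂ (v := ⟨j, hj⟩) htail hj₂
  rw [Cmd.run]
  split_ifs with h
  swap
  · exact ⟨.refl, fun hj c h1 => absurd (hadj.mpr h1) h⟩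
  rw [hadj] at h
  have key := run_loop_propagates (G := G) (n := n) (i := iE) (b := aThree)
    (p := .ite (.sub (listSum iTail) (.read aCur (pos iTail iE))) .skip
        (.write aCur (pos iHead iE) (.const 0))) (by decide) (by decide) s₂
    (Q := fun d W => ∀ hd : d < 3, lists n (s aCur) ⟨k, hk⟩ ⊆ {⟨d, hd⟩} →
      (⟨d, hd⟩ : Fin 3) ∉ W ⟨j, hj⟩)
    (fun d W W' h h1 hd => hmono h (h1 hd)) ?_
  · exact ⟨key.1, fun _ c _ => key.2 c (by rw [hs₂.three_eq]; exact c.2) c.2⟩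
  intro d s₃ hd hd₃ hfr₃ hp₃
  rw [hs₂.three_eq] at hd
  have htail₃ : s₃ iTail 0 = ((⟨k, hk⟩ : Fin n) : ℕ) := by rw [hfr₃ iTail (by decide), htail]
  have hhead₃ : s₃ iHead 0 = ((⟨j, hj⟩ : Fin n) : ℕ) := by rw [hfr₃ iHead (by decide), hj₂]
  have hd₃' : s₃ iE 0 = ((⟨d, hd⟩ : Fin 3) : ℕ) := hd₃
  have hsub := eval_other_eq_zero htail₃ hd₃'
  rw [Cmd.run]
  split_ifs with h0
  · refine ⟨.refl, fun _ h1 => absurd (hsub.mpr ?_) h0⟩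
    exact ((hp₁.trans hp₂).trans hp₃ |>.subset _).trans h1
  · rw [not_not, hsub] at h0
    rw [Cmd.run, State.set_same]
    have hpos : (pos iHead iE).eval s₃
        = 3 * ((⟨j, hj⟩ : Fin n) : ℕ) + ((⟨d, hd⟩ : Fin 3) : ℕ) := by
      simp only [Expr.eval, hhead₃, hd₃']; omega
    rw [hpos]
    have hupd : lists n (Function.update (s₃ aCur)
        (3 * ((⟨j, hj⟩ : Fin n) : ℕ) + ((⟨d, hd⟩ : Fin 3) : ℕ)) 0)
        = Function.update (lists n (s₃ aCur)) ⟨j, hj⟩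
          ((lists n (s₃ aCur) ⟨j, hj⟩).erase ⟨d, hd⟩) := by
      funext v
      ext c
      rw [mem_lists_update]
      by_cases hv : v = ⟨j, hj⟩
      · subst hv; simp [and_comm]
      · simp [hv]
    show Propagates G _ (lists n (Function.update (s₃ aCur) _ 0)) ∧ _
    refine ⟨?_, fun _ _ => ?_⟩
    · rw [hupd]
      exact Propagates.refl.erase h h0
    · show _ ∉ lists n (Function.update (s₃ aCur) _ 0) _
      rw [hupd]
      simp

/-- Each pass removes some color unless the lists are closed, so `3 * n` passes suffice. -/
lemma run_propagate {s : State} (hs : Ready G L len s) :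
    Propagates G (lists n (s aCur)) (lists n (propagate.run s aCur)) ∧
      Closed G (lists n (propagate.run s aCur)) := by
  have key := run_loop_induct (i := iSweep) (b := aPairs) (p := sweep) (by decide) s
    (fun k s' => Propagates G (lists n (s aCur)) (lists n (s' aCur)) ∧
      (Closed G (lists n (s' aCur)) ∨ ∑ v, (lists n (s' aCur) v).card + k ≤ 3 * n)) ?_ ?_
  · rw [hs.pairs_eq] at key
    refine ⟨key.1, key.2.elim id fun h u v c _ _ => ?_⟩
    have h0 : ∑ v, (lists n (propagate.run s aCur) v).card = 0 := by
      rw [propagate]; omega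
    rw [Finset.card_eq_zero.mp (Finset.sum_eq_zero_iff.mp h0 v (Finset.mem_univ _))]
    simp
  · rw [State.set_of_ne _ _ _ (by decide)]
    refine ⟨.refl, Or.inr ?_⟩
    rw [add_zero]
    refine (Finset.sum_le_card_nsmul _ _ 3 fun v _ =>
      (Finset.card_le_univ (lists n (s aCur) v)).trans (by simp)).trans ?_
    simp [mul_comm]
  · intro k s' hk hk' hfr ih
    rw [State.set_of_ne _ _ _ (by decide)]
    obtain ⟨h1, h2⟩ := run_sweep (hs.of_frame hfr)
    refine ⟨ih.1.trans h1, ?_⟩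
    rcases ih.2 with hcl | hcard
    · left
      rw [h1.eq_of_closed hcl]
      exact hcl
    · by_cases hcl : Closed G (lists n (s' aCur))
      · left
        rw [h1.eq_of_closed hcl]
        exact hcl
      right
      simp only [Closed, not_forall, not_not] at hcl
      obtain ⟨u, v, c, hadj, hu, hv⟩ := hcl
      have hlt : ∑ v, (lists n (sweep.run s' aCur) v).card < ∑ v, (lists n (s' aCur) v).card := by
        refine Finset.sum_lt_sum (fun v _ => Finset.card_le_card (h1.subset v))
          ⟨v, Finset.mem_univ _, Finset.card_lt_card ?_⟩
        exact (Finset.ssubset_iff_of_subset (h1.subset v)).mpr ⟨c, hv, h2 u v c hadj hu⟩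
      omega

lemma run_findEmpty {s : State} (hs : Ready G L len s) :
    findEmpty.run s aBad 0 ≠ 0 ↔ ∃ v, lists n (s aCur) v = ∅ := by
  set s₀ := (assign aBad (.const 0)).run s with hs₀
  have hcur : s₀ aCur = s aCur := run_of_notMem_writes _ _ (by decide)
  have hr : Ready G L len s₀ := hs.run
  have key := run_loop_induct (i := iTail) (b := aN)
    (p := .ite (listSum iTail) .skip (assign aBad (.const 1))) (by decide) s₀
    (fun k s' => s' aBad 0 ≠ 0 ↔ ∃ v : Fin n, (v : ℕ) < k ∧ lists n (s aCur) v = ∅) ?_ ?_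
  · rw [hr.n_eq] at key
    rw [findEmpty, Cmd.run, key]
    exact exists_congr fun v => ⟨fun h => h.2, fun h => ⟨v.2, h⟩⟩
  · rw [State.set_of_ne _ _ _ (by decide), hs₀, Cmd.run, State.set_apply]
    simp [Expr.eval]
  · intro k s' hk hk' hfr ih
    rw [hr.n_eq] at hk
    rw [State.set_of_ne _ _ _ (by decide), Cmd.run]
    have hev := eval_listSum_eq_zero (n := n) (s := s') (a := iTail) (u := ⟨k, hk⟩) hk'
    rw [hfr aCur (by decide), hcur] at hev
    have hsplit : (∃ v : Fin n, (v : ℕ) < k + 1 ∧ lists n (s aCur) v = ∅) ↔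
        (∃ v : Fin n, (v : ℕ) < k ∧ lists n (s aCur) v = ∅) ∨ lists n (s aCur) ⟨k, hk⟩ = ∅ := by
      constructor
      · rintro ⟨v, hv, h⟩
        by_cases hvk : (v : ℕ) = k
        · right
          rwa [show (⟨k, hk⟩ : Fin n) = v from Fin.ext hvk.symm]
        · exact Or.inl ⟨v, by omega, h⟩
      · rintro (⟨v, hv, h⟩ | h)
        · exact ⟨v, by omega, h⟩
        · exact ⟨_, Nat.lt_succ_self _, h⟩
    rw [hsplit, ← hev]
    split_ifs with h
    · rw [Cmd.run, ih]
      simp [h]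
    · rw [not_not] at h
      exact ⟨fun _ => Or.inr h, fun _ => by simp [Cmd.run, Expr.eval]⟩

/-- Trying a color keeps the lists solvable and enlarges none of them.  Afterwards the list of the
vertex lacks the color or has no other color. -/
lemma run_tryColor {s : State} (hs : Ready G L len s) {v : Fin n} {c : Fin 3}
    (hv : s iV 0 = v) (hc : s iC 0 = c) (hcard : ∀ u, (lists n (s aCur) u).card ≤ 2)
    (hψ : ∃ ψ, Respects G (lists n (s aCur)) ψ) :
    (∀ u, lists n (tryColor.run s aCur) u ⊆ lists n (s aCur) u) ∧
      (∃ ψ, Respects G (lists n (tryColor.run s aCur)) ψ) ∧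
      (c ∈ lists n (tryColor.run s aCur) v → lists n (tryColor.run s aCur) v ⊆ {c}) := by
  obtain ⟨ψ, hψ⟩ := hψ
  set s₁ := (copyLists aCur aSave).run s with hs₁
  set s₂ := restrict.run s₁ with hs₂
  set s₃ := propagate.run s₂ with hs₃
  set s₄ := findEmpty.run s₃ with hs₄
  have hr₁ : Ready G L len s₁ := hs.run
  have hr₂ : Ready G L len s₂ := hr₁.run
  have hr₃ : Ready G L len s₃ := hr₂.run
  have hr₄ : Ready G L len s₄ := hr₃.run
  have hcur₁ : s₁ aCur = s aCur := run_of_notMem_writes _ _ (by decide)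
  have hcur₄ : s₄ aCur = s₃ aCur := run_of_notMem_writes _ _ (by decide)
  have hsave : lists n (s₄ aSave) = lists n (s aCur) := by
    rw [show s₄ aSave = s₁ aSave from
      (run_of_notMem_writes findEmpty _ (by decide)).trans <|
      (run_of_notMem_writes propagate _ (by decide)).trans <|
      run_of_notMem_writes restrict _ (by decide)]
    exact lists_run_copyLists (by decide) (by decide) (by decide) hs
  have hv₁ : s₁ iV 0 = v := by rw [hs₁, run_of_notMem_writes _ _ (by decide), hv]
  have hc₁ : s₁ iC 0 = c := by rw [hs₁, run_of_notMem_writes _ _ (by decide), hc]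
  have hmem := mem_lists_run_restrict hr₁ hv₁ hc₁
  rw [← hs₂, hcur₁] at hmem
  obtain ⟨hprop, hclosed⟩ := run_propagate hr₂
  rw [← hs₃] at hprop hclosed
  have hsub : ∀ u, lists n (s₃ aCur) u ⊆ lists n (s aCur) u := fun u d hd =>
    ((hmem u d).mp (hprop.subset u hd)).1
  have hbad : s₄ aBad 0 ≠ 0 ↔ ∃ v, lists n (s₃ aCur) v = ∅ := run_findEmpty hr₃
  have hrun : tryColor.run s = (Cmd.ite (.var aBad)
      (copyLists aSave aCur ;; .write aCur (pos iV iC) (.const 0)) .skip).run s₄ := rfl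
  rw [hrun, Cmd.run]
  split_ifs with h
  · -- Some list became empty, so no solution has color `c` at `v`.
    set s₅ := (copyLists aSave aCur).run s₄ with hs₅
    have hcur₅ : lists n (s₅ aCur) = lists n (s aCur) := by
      rw [← hsave]
      exact lists_run_copyLists (by decide) (by decide) (by decide) hr₄
    have hv₅ : s₅ iV 0 = v := by
      rw [hs₅, run_of_notMem_writes _ _ (by decide), hs₄, run_of_notMem_writes _ _ (by decide), hs₃,
        run_of_notMem_writes _ _ (by decide), hs₂, run_of_notMem_writes _ _ (by decide), hv₁]
    have hc₅ : s₅ iC 0 = c := by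
      rw [hs₅, run_of_notMem_writes _ _ (by decide), hs₄, run_of_notMem_writes _ _ (by decide), hs₃,
        run_of_notMem_writes _ _ (by decide), hs₂, run_of_notMem_writes _ _ (by decide), hc₁]
    have hfin : (copyLists aSave aCur ;; .write aCur (pos iV iC) (.const 0)).run s₄ aCur
        = Function.update (s₅ aCur) (3 * (v : ℕ) + (c : ℕ)) 0 := by
      rw [Cmd.run, Cmd.run, State.set_same, ← hs₅]
      simp only [Expr.eval, hv₅, hc₅]
      congr 1
      omega
    rw [hfin]
    have hmem₅ : ∀ u d, d ∈ lists n (Function.update (s₅ aCur) (3 * (v : ℕ) + (c : ℕ)) 0) u ↔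
        d ∈ lists n (s aCur) u ∧ (u = v → d ≠ c) := fun u d => by
      rw [mem_lists_update, hcur₅]
    refine ⟨fun u d hd => ((hmem₅ u d).mp hd).1, ⟨ψ, hψ.1, fun u => ?_⟩,
      fun hcv => absurd rfl (((hmem₅ v c).mp hcv).2 rfl)⟩
    rw [hmem₅]
    refine ⟨hψ.2 u, ?_⟩
    rintro rfl hcu
    obtain ⟨x, hx⟩ := hbad.mp h
    have h1 : Respects G (lists n (s₂ aCur)) ψ := ⟨hψ.1, fun y => (hmem y _).mpr
      ⟨hψ.2 y, fun hy => by rw [hy, hcu]⟩⟩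
    have h2 := (hprop.respects h1).2 x
    rw [hx] at h2
    simp at h2
  · rw [Cmd.run, hcur₄]
    have h1 : ¬ ∃ v, lists n (s₃ aCur) v = ∅ := fun h1 => h (hbad.mpr h1)
    push Not at h1
    refine ⟨hsub, exists_respects_of_closed hcard hψ hsub hclosed fun v h2 => ?_, fun _ d hd => ?_⟩
    · have := h1 v
      rw [h2] at this
      simp at this
    · rw [Finset.mem_singleton]
      exact ((hmem v d).mp (hprop.subset v hd)).2 rfl

/-- Solvable lists of size at most two end up as the singletons of a solution. -/
lemma run_greedy {s : State} (hs : Ready G L len s)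
    (hcard : ∀ u, (lists n (s aCur) u).card ≤ 2)
    (hψ : ∃ ψ, Respects G (lists n (s aCur)) ψ) :
    (∀ u, lists n (greedy.run s aCur) u ⊆ lists n (s aCur) u) ∧
      ∃ ψ, Respects G (lists n (greedy.run s aCur)) ψ ∧
        ∀ v, lists n (greedy.run s aCur) v ⊆ {ψ v} := by
  have key := run_loop_induct (i := iV) (b := aN) (p := .loop iC aThree tryColor) (by decide) s
    (fun k s' => (∀ u, lists n (s' aCur) u ⊆ lists n (s aCur) u) ∧
      (∃ ψ, Respects G (lists n (s' aCur)) ψ) ∧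
      ∀ v : Fin n, (v : ℕ) < k → ∀ c ∈ lists n (s' aCur) v, lists n (s' aCur) v ⊆ {c}) ?_ ?_
  · rw [hs.n_eq] at key
    obtain ⟨h1, ⟨ψ, hψ⟩, h3⟩ := key
    exact ⟨h1, ψ, hψ, fun v => h3 v v.2 _ (hψ.2 v)⟩
  · rw [State.set_of_ne _ _ _ (by decide)]
    exact ⟨fun _ => subset_rfl, hψ, by simp⟩
  intro k s₁ hk hk₁ hfr₁ ih
  rw [hs.n_eq] at hk
  have hr₁ := hs.of_frame hfr₁
  rw [State.set_of_ne _ _ _ (by decide)]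
  have key := run_loop_induct (i := iC) (b := aThree) (p := tryColor) (by decide) s₁
    (fun d s' => (∀ u, lists n (s' aCur) u ⊆ lists n (s₁ aCur) u) ∧
      (∃ ψ, Respects G (lists n (s' aCur)) ψ) ∧
      ∀ c : Fin 3, (c : ℕ) < d → c ∈ lists n (s' aCur) ⟨k, hk⟩ →
        lists n (s' aCur) ⟨k, hk⟩ ⊆ {c}) ?_ ?_
  · rw [hr₁.three_eq] at key
    obtain ⟨h1, h2, h3⟩ := key
    refine ⟨fun u => (h1 u).trans (ih.1 u), h2, fun v hv c hc => ?_⟩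
    by_cases hvk : (v : ℕ) = k
    · obtain rfl : v = ⟨k, hk⟩ := Fin.ext hvk
      exact h3 c c.2 hc
    · exact (h1 v).trans (ih.2.2 v (by omega) c (h1 v hc))
  · rw [State.set_of_ne _ _ _ (by decide)]
    exact ⟨fun _ => subset_rfl, ih.2.1, by simp⟩
  intro d s₂ hd hd₂ hfr₂ ih₂
  rw [hr₁.three_eq] at hd
  rw [State.set_of_ne _ _ _ (by decide)]
  obtain ⟨h1, h2, h3⟩ := run_tryColor (hr₁.of_frame hfr₂) (v := ⟨k, hk⟩) (c := ⟨d, hd⟩)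
    (by rw [hfr₂ iV (by decide), hk₁]) hd₂
    (fun u => (Finset.card_le_card ((ih₂.1 u).trans (ih.1 u))).trans (hcard u)) ih₂.2.1
  refine ⟨fun u => (h1 u).trans (ih₂.1 u), h2, fun c hc hmem => ?_⟩
  by_cases hcd : (c : ℕ) = d
  · obtain rfl : c = ⟨d, hd⟩ := Fin.ext hcd
    exact h3 hmem
  · exact (h1 _).trans (ih₂.2.2 c (by omega) (h1 _ hmem))

lemma run_divide {s : State} (hs : Ready G L len s) (hn : 0 < n)
    (hlt : s aCode 0 < (3 * n) ^ len) :
    divide.run s aCode 0 = s aCode 0 % (3 * n) ∧ divide.run s aQuot 0 = s aCode 0 / (3 * n) := by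
  set s₀ := (assign aQuot (.const 0)).run s with hs₀
  have hr : Ready G L len s₀ := hs.run
  have hcode : s₀ aCode = s aCode := run_of_notMem_writes _ _ (by decide)
  have key := run_loop_induct (i := iDiv) (b := aNum)
    (p := .ite (.sub (.add (.var aCode) (.const 1)) (.var aPairs))
    (assign aCode (.sub (.var aCode) (.var aPairs)) ;;
      assign aQuot (.add (.var aQuot) (.const 1))) .skip) (by decide) s₀
    (fun k s' => s' aCode 0 + 3 * n * s' aQuot 0 = s aCode 0 ∧
      (s' aCode 0 < 3 * n ∨ s' aQuot 0 = k)) ?_ ?_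
  · rw [hr.num_eq] at key
    have hrun : divide.run s = (Cmd.loop iDiv aNum
      (.ite (.sub (.add (.var aCode) (.const 1)) (.var aPairs))
        (assign aCode (.sub (.var aCode) (.var aPairs)) ;;
        assign aQuot (.add (.var aQuot) (.const 1))) .skip)).run s₀ := rfl
    rw [← hrun] at key
    obtain ⟨h1, h2⟩ := key
    have hlt' : divide.run s aCode 0 < 3 * n := by
      refine h2.resolve_right fun h2 => ?_
      rw [h2] at h1
      have : 1 * (3 * n) ^ len ≤ 3 * n * (3 * n) ^ len := Nat.mul_le_mul_right _ (by omega)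
      omega
    rw [← h1, Nat.add_mul_mod_self_left, Nat.mod_eq_of_lt hlt',
      Nat.add_mul_div_left _ _ (by omega), Nat.div_eq_of_lt hlt', zero_add]
    exact ⟨rfl, rfl⟩
  · rw [State.set_of_ne _ _ _ (by decide), State.set_of_ne _ _ _ (by decide), hcode]
    simp [hs₀, Cmd.run, Expr.eval]
  · intro k s' hk hk' hfr ih
    have hp : s' aPairs 0 = 3 * n := by rw [hfr aPairs (by decide), hr.pairs_eq]
    rw [State.set_of_ne _ _ _ (by decide), State.set_of_ne _ _ _ (by decide), Cmd.run]
    simp only [Expr.eval, hp]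
    by_cases h : 3 * n ≤ s' aCode 0
    · rw [if_pos (by omega)]
      simp only [Cmd.run, State.set_apply, Expr.eval, hp]
      simp only [true_and, if_true]
      rw [if_neg (by decide), if_neg (by decide)]
      constructor
      · have := ih.1
        rw [mul_add, mul_one]
        omega
      · right
        have := ih.2
        omega
    · rw [if_neg (by omega), Cmd.run]
      exact ⟨ih.1, Or.inl (by omega)⟩

/-- The number with the given base-`3 * n` digits, each of which encodes a vertex and a color. -/
def encode : List (Fin n × Fin 3) → ℕ
  | [] => 0
  | (v, c) :: l => (3 * (v : ℕ) + (c : ℕ)) + 3 * n * encode l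

lemma encode_lt : ∀ l : List (Fin n × Fin 3), encode l < (3 * n) ^ l.length
  | [] => by simp [encode]
  | (v, c) :: l => by
    have h1 := encode_lt l
    have h2 : 3 * n * (encode l + 1) ≤ 3 * n * (3 * n) ^ l.length := Nat.mul_le_mul_left _ h1
    have := v.2
    have := c.2
    rw [encode, List.length_cons, pow_succ']
    rw [mul_add] at h2
    omega

/-- Applying a guess that encodes colors of a coloring `φ` from the lists keeps `φ` and reduces the
lists of the guessed vertices to their colors. -/
lemma run_applyGuess {s : State} (hs : Ready G L len s) (hn : 0 < n) {φ : Fin n → Fin 3}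
    {l : List (Fin n)} (hl : l.length = len)
    (hcode : s aCode 0 = encode (l.map fun v => (v, φ v)))
    (hφ : Respects G (lists n (s aCur)) φ) :
    (∀ u, lists n (applyGuess.run s aCur) u ⊆ lists n (s aCur) u) ∧
      Respects G (lists n (applyGuess.run s aCur)) φ ∧
      ∀ v ∈ l, lists n (applyGuess.run s aCur) v ⊆ {φ v} := by
  have key := run_loop_induct (i := iDigit) (b := aLen) (p := divide ;;
      .loop iV aN (.loop iC aThree (.ite (neq (.var aCode) (pos iV iC)) .skip restrict)) ;;
      assign aCode (.var aQuot)) (by decide) s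
    (fun k s' => s' aCode 0 = encode ((l.drop k).map fun v => (v, φ v)) ∧
      (∀ u, lists n (s' aCur) u ⊆ lists n (s aCur) u) ∧
      Respects G (lists n (s' aCur)) φ ∧
      ∀ v ∈ l.take k, lists n (s' aCur) v ⊆ {φ v}) ?_ ?_
  · rw [hs.len_eq, ← hl, List.take_length] at key
    exact key.2
  · rw [State.set_of_ne _ _ _ (by decide), State.set_of_ne _ _ _ (by decide)]
    exact ⟨hcode, fun _ => subset_rfl, hφ, by simp⟩
  intro k s₁ hk hk₁ hfr₁ ih
  obtain ⟨ih1, ih2, ih3, ih4⟩ := ih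
  rw [hs.len_eq, ← hl] at hk
  have hr₁ := hs.of_frame hfr₁
  rw [State.set_of_ne _ _ _ (by decide), State.set_of_ne _ _ _ (by decide)]
  have hdrop : l.drop k = l[k] :: l.drop (k + 1) := List.drop_eq_getElem_cons hk
  set v := l[k] with hv
  rw [hdrop, List.map_cons, encode] at ih1
  obtain ⟨hmod, hdiv⟩ := run_divide hr₁ hn (by
    rw [ih1]
    have h1 := encode_lt ((v, φ v) :: (l.drop (k + 1)).map fun v => (v, φ v))
    rw [encode] at h1
    refine h1.trans_le (Nat.pow_le_pow_right (by omega) ?_)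
    simp
    omega)
  have hdig : 3 * (v : ℕ) + (φ v : ℕ) < 3 * n := by
    have := v.2
    have := (φ v).2
    omega
  rw [ih1, Nat.add_mul_mod_self_left, Nat.mod_eq_of_lt hdig] at hmod
  rw [ih1, Nat.add_mul_div_left _ _ (by omega), Nat.div_eq_of_lt hdig, zero_add] at hdiv
  set s₂ := divide.run s₁ with hs₂
  have hr₂ : Ready G L len s₂ := hr₁.run
  have hcur₂ : s₂ aCur = s₁ aCur := run_of_notMem_writes _ _ (by decide)
  set s₃ := (Cmd.loop iV aN
    (.loop iC aThree (.ite (neq (.var aCode) (pos iV iC)) .skip restrict))).run s₂ with hs₃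
  have hquot₃ : s₃ aQuot = s₂ aQuot := run_of_notMem_writes _ _ (by decide)
  have hmain : (∀ u, lists n (s₃ aCur) u ⊆ lists n (s₁ aCur) u) ∧
      Respects G (lists n (s₃ aCur)) φ ∧ lists n (s₃ aCur) v ⊆ {φ v} := by
    have key := run_loop_induct (i := iV) (b := aN)
      (p := .loop iC aThree (.ite (neq (.var aCode) (pos iV iC)) .skip restrict)) (by decide) s₂
      (fun k s' => (∀ u, lists n (s' aCur) u ⊆ lists n (s₁ aCur) u) ∧
        Respects G (lists n (s' aCur)) φ ∧ ((v : ℕ) < k → lists n (s' aCur) v ⊆ {φ v})) ?_ ?_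
    · rw [hr₂.n_eq] at key
      exact ⟨key.1, key.2.1, key.2.2 v.2⟩
    · rw [State.set_of_ne _ _ _ (by decide), hcur₂]
      exact ⟨fun _ => subset_rfl, ih3, by simp⟩
    intro x s₄ hx hx₄ hfr₄ ih₄
    rw [hr₂.n_eq] at hx
    have hr₄ := hr₂.of_frame hfr₄
    rw [State.set_of_ne _ _ _ (by decide)]
    have key := run_loop_induct (i := iC) (b := aThree)
      (p := .ite (neq (.var aCode) (pos iV iC)) .skip restrict) (by decide) s₄
      (fun d s' => (∀ u, lists n (s' aCur) u ⊆ lists n (s₄ aCur) u) ∧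
        Respects G (lists n (s' aCur)) φ ∧
        ((v : ℕ) = x ∧ (φ v : ℕ) < d → lists n (s' aCur) v ⊆ {φ v})) ?_ ?_
    · rw [hr₄.three_eq] at key
      obtain ⟨h1, h2, h3⟩ := key
      refine ⟨fun u => (h1 u).trans (ih₄.1 u), h2, fun hvx => ?_⟩
      by_cases h : (v : ℕ) = x
      · exact h3 ⟨h, (φ v).2⟩
      · exact (h1 v).trans (ih₄.2.2 (by omega))
    · rw [State.set_of_ne _ _ _ (by decide)]
      exact ⟨fun _ => subset_rfl, ih₄.2.1, by simp⟩
    intro d s₅ hd hd₅ hfr₅ ih₅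
    rw [hr₄.three_eq] at hd
    have hr₅ := hr₄.of_frame hfr₅
    rw [State.set_of_ne _ _ _ (by decide)]
    have hcode₅ : s₅ aCode 0 = 3 * (v : ℕ) + (φ v : ℕ) := by
      rw [hfr₅ aCode (by decide), hfr₄ aCode (by decide), hmod]
    have hx₅ : s₅ iV 0 = x := by rw [hfr₅ iV (by decide), hx₄]
    have hφ3 := (φ v).2
    have hev : (neq (.var aCode) (pos iV iC)).eval s₅ = 0 ↔ (v : ℕ) = x ∧ (φ v : ℕ) = d := by
      simp only [Expr.eval, hcode₅, hx₅, hd₅]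
      omega
    rw [Cmd.run]
    split_ifs with h
    · rw [Cmd.run]
      rw [ne_eq, hev] at h
      exact ⟨ih₅.1, ih₅.2.1, fun h' => ih₅.2.2 ⟨h'.1, by omega⟩⟩
    · rw [not_not, hev] at h
      have hmem := mem_lists_run_restrict hr₅ (v := v) (c := φ v) (hx₅.trans h.1.symm)
        (hd₅.trans h.2.symm)
      refine ⟨fun u e he => ih₅.1 u ((hmem u e).mp he).1, ⟨hφ.1, fun u => ?_⟩, fun _ e he => ?_⟩
      · rw [hmem]
        exact ⟨ih₅.2.1.2 u, fun h => by rw [h]⟩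
      · rw [Finset.mem_singleton]
        exact ((hmem v e).mp he).2 rfl
  have hcur₄ : (assign aCode (.var aQuot)).run s₃ aCur = s₃ aCur :=
    run_of_notMem_writes _ _ (by decide)
  have hrun : (divide ;; .loop iV aN
      (.loop iC aThree (.ite (neq (.var aCode) (pos iV iC)) .skip restrict)) ;;
      assign aCode (.var aQuot)).run s₁ = (assign aCode (.var aQuot)).run s₃ := rfl
  rw [hrun, hcur₄]
  refine ⟨?_, fun u => (hmain.1 u).trans (ih2 u), hmain.2.1, fun u hu => ?_⟩
  · rw [Cmd.run]
    simp only [Expr.eval, State.set_self, hquot₃]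
    exact hdiv
  · rw [List.take_succ_eq_append_getElem hk, List.mem_append, List.mem_singleton] at hu
    rcases hu with hu | rfl
    · exact (hmain.1 u).trans (ih4 u hu)
    · exact hmain.2.2

/-- The output assigns a color to every vertex, the one in its list if this is a singleton. -/
lemma run_readOff {s : State} (hs : Ready G L len s) :
    ∃ ψ : Fin n → Fin 3, (∀ v : Fin n, readOff.run s aOut v = ψ v) ∧
      ∀ v c, c ∈ lists n (s aCur) v → lists n (s aCur) v ⊆ {c} → ψ v = c := by
  have key := run_loop_induct (i := iV) (b := aN) (p := .write aOut (.var iV)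
    (.add (.sub (.const 1) (.read aCur (triple iV)))
      (.sub (.sub (.const 1) (.read aCur (triple iV)))
        (.read aCur (.add (triple iV) (.const 1)))))) (by decide) s
    (fun k s' => ∀ v < k, s' aOut v = (1 - s aCur (3 * v)) +
      ((1 - s aCur (3 * v)) - s aCur (3 * v + 1))) (by simp) ?_
  · rw [hs.n_eq] at key
    refine ⟨fun v => ⟨(1 - s aCur (3 * v)) + ((1 - s aCur (3 * v)) - s aCur (3 * v + 1)), by omega⟩,
      fun v => key v v.2, fun v c hc hsub => Fin.ext ?_⟩
    have h1 : ∀ d : Fin 3, d ≠ c → s aCur (3 * (v : ℕ) + (d : ℕ)) = 0 := by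
      intro d hd
      by_contra h
      exact hd (Finset.mem_singleton.mp (hsub (mem_lists.mpr h)))
    rw [mem_lists] at hc
    clear hsub
    fin_cases c <;> simp [Fin.forall_fin_succ] at h1 hc ⊢ <;> omega
  · intro k s' hk hk' hfr ih v hv
    have hcur : s' aCur = s aCur := hfr aCur (by decide)
    rw [State.set_of_ne _ _ _ (by decide), Cmd.run, State.set_apply]
    simp only [Expr.eval, hk', hcur, show k + (k + k) = 3 * k by omega]
    by_cases h : v = k
    · simp [h]
    · rw [if_neg (by simp [h])]
      exact ih v (by omega)

/-- The flag in array `a` tells whether `P` holds. -/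
def Flag (a : ℕ) (s : State) (P : Prop) : Prop :=
  (s a 0 = 1 ∧ P) ∨ (s a 0 = 0 ∧ ¬ P)

lemma Flag.congr {a : ℕ} {s : State} {P Q : Prop} (h : Flag a s P) (hPQ : P ↔ Q) :
    Flag a s Q := by
  rwa [Flag, ← hPQ]

lemma Flag.set_of_ne {a b i x : ℕ} {s : State} {P : Prop} (h : Flag a s P) (hab : a ≠ b) :
    Flag a (s.set b i x) P := by
  rwa [Flag, State.set_of_ne _ _ _ hab]

/-- A test that resets the flag on failure adds its condition to the flag. -/
lemma Flag.run_test {a : ℕ} {s : State} {P Q : Prop} {e : Expr} (h : Flag a s P)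
    (he : e.eval s ≠ 0 ↔ Q) :
    Flag a ((Cmd.ite e .skip (assign a (.const 0))).run s) (P ∧ Q) := by
  rw [Cmd.run]
  split_ifs with h0
  · exact h.congr ⟨fun hP => ⟨hP, he.mp h0⟩, fun hPQ => hPQ.1⟩
  · rw [Cmd.run]
    exact Or.inr ⟨by simp [Expr.eval], fun hPQ => h0 (he.mpr hPQ.2)⟩

lemma forall_fin_lt_succ {k : ℕ} (hk : k < n) {Q : Fin n → Prop} :
    (∀ v : Fin n, (v : ℕ) < k + 1 → Q v) ↔ (∀ v : Fin n, (v : ℕ) < k → Q v) ∧ Q ⟨k, hk⟩ := by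
  constructor
  · exact fun h => ⟨fun v hv => h v (by omega), h _ (Nat.lt_succ_self k)⟩
  · rintro ⟨h1, h2⟩ v hv
    by_cases hvk : (v : ℕ) = k
    · rwa [show v = ⟨k, hk⟩ from Fin.ext hvk]
    · exact h1 v (by omega)

lemma run_verify {s : State} (hs : Ready G L len s) {ψ : Fin n → Fin 3}
    (hψ : ∀ v : Fin n, s aOut v = ψ v) : Flag aFound (verify.run s) (IsSolution G L ψ) := by
  set s₀ := (assign aOk (.const 1)).run s with hs₀
  have hr₀ : Ready G L len s₀ := hs.run
  have hout₀ : s₀ aOut = s aOut := run_of_notMem_writes _ _ (by decide)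
  set s₁ := (Cmd.loop iV aN
    (.ite (.read aList (.add (triple iV) (.read aOut (.var iV)))) .skip (assign aOk (.const 0)) ;;
    .loop iTail aN (.ite (adjE iV iTail)
      (.ite (neq (.read aOut (.var iV)) (.read aOut (.var iTail))) .skip (assign aOk (.const 0)))
      .skip))).run s₀ with hs₁
  have key : Flag aOk s₁ (∀ v : Fin n, (v : ℕ) < s₀ aN 0 → ψ v ∈ L v ∧
      ∀ u : Fin n, (u : ℕ) < n → G.Adj v u → ψ v ≠ ψ u) := by
    refine run_loop_induct (by decide) s₀ (fun k s' => Flag aOk s' (∀ v : Fin n, (v : ℕ) < k →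
      ψ v ∈ L v ∧ ∀ u : Fin n, (u : ℕ) < n → G.Adj v u → ψ v ≠ ψ u)) ?_ ?_
    · refine Flag.set_of_ne (Or.inl ⟨?_, by simp⟩) (by decide)
      simp [hs₀, Cmd.run, Expr.eval]
    intro k s₂ hk hk₂ hfr₂ ih
    rw [hr₀.n_eq] at hk
    have hr₂ := hr₀.of_frame hfr₂
    have hout₂ : ∀ v : Fin n, s₂ aOut v = ψ v := fun v => by
      rw [hfr₂ aOut (by decide), hout₀, hψ]
    refine Flag.set_of_ne ?_ (by decide)
    rw [Cmd.run]
    have hk₂' : s₂ iV 0 = ((⟨k, hk⟩ : Fin n) : ℕ) := hk₂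
    have htest := ih.run_test (e := .read aList (.add (triple iV) (.read aOut (.var iV))))
      (Q := ψ ⟨k, hk⟩ ∈ L ⟨k, hk⟩) (by
        rw [← hr₂.list_eq, mem_lists, ← hout₂]
        simp only [Expr.eval, hk₂', show k + (k + k) = 3 * k by omega])
    set s₃ := (Cmd.ite (.read aList (.add (triple iV) (.read aOut (.var iV)))) .skip
      (assign aOk (.const 0))).run s₂ with hs₃
    have hr₃ : Ready G L len s₃ := hr₂.run
    have hout₃ : s₃ aOut = s₂ aOut := run_of_notMem_writes _ _ (by decide)
    have hv₃ : s₃ iV 0 = ((⟨k, hk⟩ : Fin n) : ℕ) := by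
      rw [hs₃, run_of_notMem_writes _ _ (by decide), hk₂']
    have key := run_loop_induct (i := iTail) (b := aN) (p := .ite (adjE iV iTail)
      (.ite (neq (.read aOut (.var iV)) (.read aOut (.var iTail))) .skip (assign aOk (.const 0)))
      .skip) (by decide) s₃ (fun j s' => Flag aOk s' (((∀ v : Fin n, (v : ℕ) < k →
      ψ v ∈ L v ∧ ∀ u : Fin n, (u : ℕ) < n → G.Adj v u → ψ v ≠ ψ u) ∧ ψ ⟨k, hk⟩ ∈ L ⟨k, hk⟩) ∧
      ∀ u : Fin n, (u : ℕ) < j → G.Adj ⟨k, hk⟩ u → ψ ⟨k, hk⟩ ≠ ψ u)) ?_ ?_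
    · rw [hr₃.n_eq] at key
      refine key.congr ?_
      rw [forall_fin_lt_succ hk, and_assoc]
    · exact (htest.set_of_ne (by decide)).congr (by simp)
    intro j s₄ hj hj₄ hfr₄ ih₄
    rw [hr₃.n_eq] at hj
    have hr₄ := hr₃.of_frame hfr₄
    have hv₄ : s₄ iV 0 = ((⟨k, hk⟩ : Fin n) : ℕ) := by rw [hfr₄ iV (by decide), hv₃]
    have hj₄' : s₄ iTail 0 = ((⟨j, hj⟩ : Fin n) : ℕ) := hj₄
    have hadj := eval_adjE_ne_zero hr₄ hv₄ hj₄'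
    have hout₄ : ∀ v : Fin n, s₄ aOut v = ψ v := fun v => by
      rw [hfr₄ aOut (by decide), hout₃, hout₂]
    refine Flag.set_of_ne ?_ (by decide)
    rw [Cmd.run]
    split_ifs with h
    · refine (ih₄.run_test (Q := ψ ⟨k, hk⟩ ≠ ψ ⟨j, hj⟩) ?_).congr ?_
      · have h1 := hout₄ ⟨k, hk⟩
        have h2 := hout₄ ⟨j, hj⟩
        dsimp only at h1 h2
        simp only [Expr.eval, hv₄, hj₄', h1, h2, ne_eq, Fin.ext_iff]
        omega
      · rw [forall_fin_lt_succ hj, and_assoc]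
        simp [hadj.mp h]
    · rw [Cmd.run]
      refine ih₄.congr ?_
      rw [forall_fin_lt_succ hj]
      have : ¬ G.Adj ⟨k, hk⟩ ⟨j, hj⟩ := fun h1 => h (hadj.mpr h1)
      simp [this]
  have hrun : verify.run s = s₁.set aFound 0 (s₁ aOk 0) := rfl
  rw [hrun, Flag, State.set_self]
  refine key.congr ?_
  rw [hr₀.n_eq, IsSolution]
  constructor
  · exact fun h => ⟨fun u v huv => (h u u.2).2 v v.2 huv, fun v => (h v v.2).1⟩
  · exact fun h v _ => ⟨h.2 v, fun u _ => h.1 v u⟩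

/-- An attempt never reports a wrong answer; it succeeds when the guess encodes the colors of a
solution on a seed that leaves no vertex hidden. -/
lemma run_attempt {s : State} (hs : Ready G L len s) (hn : 0 < n) :
    (∃ ψ : Fin n → Fin 3, (∀ v : Fin n, attempt.run s aOut v = ψ v) ∧
      Flag aFound (attempt.run s) (IsSolution G L ψ)) ∧
    ∀ (φ : Fin n → Fin 3) (l : List (Fin n)), IsSolution G L φ → l.length = len →
      hidden G φ l.toFinset = ∅ → s iGuess 0 = encode (l.map fun v => (v, φ v)) →
      attempt.run s aFound 0 = 1 := by
  set s₁ := (assign aCode (.var iGuess)).run s with hs₁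
  set s₂ := (copyLists aList aCur).run s₁ with hs₂
  set s₃ := applyGuess.run s₂ with hs₃
  set s₄ := propagate.run s₃ with hs₄
  set s₅ := greedy.run s₄ with hs₅
  set s₆ := readOff.run s₅ with hs₆
  have hrun : attempt.run s = verify.run s₆ := rfl
  have hr₁ : Ready G L len s₁ := hs.run
  have hr₂ : Ready G L len s₂ := hr₁.run
  have hr₃ : Ready G L len s₃ := hr₂.run
  have hr₄ : Ready G L len s₄ := hr₃.run
  have hr₅ : Ready G L len s₅ := hr₄.run
  have hr₆ : Ready G L len s₆ := hr₅.run
  obtain ⟨ψ, hout, hψ⟩ := run_readOff hr₅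
  rw [← hs₆] at hout
  have hver := run_verify hr₆ hout
  rw [← hrun] at hver
  have hout' : attempt.run s aOut = s₆ aOut := by
    rw [hrun]
    exact run_of_notMem_writes _ _ (by decide)
  refine ⟨⟨ψ, by rw [hout']; exact hout, hver⟩, fun φ l hφ hl hh hcode => ?_⟩
  have hcur₂ : lists n (s₂ aCur) = L := by
    rw [hs₂, lists_run_copyLists (by decide) (by decide) (by decide) hr₁, hr₁.list_eq]
  have hcode₂ : s₂ aCode 0 = encode (l.map fun v => (v, φ v)) := by
    rw [hs₂, run_of_notMem_writes _ _ (by decide), hs₁, Cmd.run, ← hcode]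
    simp [Expr.eval]
  obtain ⟨hsub₃, hφ₃, hl₃⟩ := run_applyGuess hr₂ hn hl hcode₂ (by rw [hcur₂]; exact hφ)
  rw [← hs₃, hcur₂] at hsub₃
  obtain ⟨hprop, hclosed⟩ := run_propagate hr₃
  have hφ₄ := hprop.respects hφ₃
  have hcard := card_le_two_of_hidden_eq_empty hclosed hφ₄ (S := l.toFinset)
    (fun v hv => (hprop.subset v).trans (hl₃ v (by simpa using hv))) hh
  obtain ⟨hsub₅, χ, hχ, hχs⟩ := run_greedy hr₄ hcard ⟨φ, hφ₄⟩
  have hψχ : ψ = χ := funext fun v => hψ v _ (hχ.2 v) (hχs v)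
  have hsol : IsSolution G L ψ := by
    rw [hψχ]
    exact ⟨hχ.1, fun v => hsub₃ v (hprop.subset v (hsub₅ v (hχ.2 v)))⟩
  exact hver.elim And.left fun h => absurd hsol h.2

/-- If every solution has a seed of at most `len` vertices that leaves no vertex hidden, then the
search answers the instance correctly. -/
lemma run_search {s : State} (hs : Ready G L len s) (hn : 0 < n) (hfound : s aFound 0 = 0)
    (hseed : ∀ φ, IsSolution G L φ → ∃ S : Finset (Fin n), S.card ≤ len ∧ hidden G φ S = ∅) :
    CorrectOutput G L (search.run s) := by
  have key := run_loop_induct (i := iGuess) (b := aNum) (p := .ite (.var aFound) .skip attempt)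
    (by decide) s (fun k s' =>
      (s' aFound 0 = 1 ∧ ∃ φ : Fin n → Fin 3, IsSolution G L φ ∧ ∀ v : Fin n, s' aOut v = φ v) ∨
      (s' aFound 0 = 0 ∧ ∀ (φ : Fin n → Fin 3) (l : List (Fin n)), IsSolution G L φ →
        l.length = len → hidden G φ l.toFinset = ∅ → k ≤ encode (l.map fun v => (v, φ v)))) ?_ ?_
  · rw [hs.num_eq] at key
    refine key.imp id fun h => ⟨h.1, fun ⟨φ, hφ⟩ => ?_⟩
    obtain ⟨S, hS, hh⟩ := hseed φ hφ
    -- The seed is padded to the length of the guesses.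
    set v₀ : Fin n := ⟨0, hn⟩
    have hlen : (S.toList ++ List.replicate (len - S.card) v₀).length = len := by
      simp
      omega
    have h1 := h.2 φ (S.toList ++ List.replicate (len - S.card) v₀) hφ hlen ?_
    · have h2 := encode_lt ((S.toList ++ List.replicate (len - S.card) v₀).map
        fun v => (v, φ v))
      rw [List.length_map, hlen] at h2
      omega
    · refine Finset.subset_empty.mp ((hidden_anti fun x hx => ?_).trans hh.subset)
      simp [hx]
  · right
    rw [State.set_of_ne _ _ _ (by decide)]
    exact ⟨hfound, by simp⟩
  · intro k s' hk hk' hfr ih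
    have hr := hs.of_frame hfr
    rw [State.set_of_ne _ _ _ (by decide), State.set_of_ne _ _ _ (by decide), Cmd.run]
    split_ifs with h
    · rw [Cmd.run]
      exact ih.imp id fun h' => absurd h'.1 h
    · rcases ih with ⟨h1, -⟩ | ⟨-, h2⟩
      · exact absurd (by simp [Expr.eval, h1]) h
      obtain ⟨⟨ψ, hψ, hflag⟩, hcomp⟩ := run_attempt hr hn
      refine hflag.imp (fun h3 => ⟨h3.1, ψ, h3.2, hψ⟩) fun h3 => ⟨h3.1, fun φ l hφ hl hh => ?_⟩
      have h4 := h2 φ l hφ hl hh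
      refine Nat.lt_of_le_of_ne h4 fun h5 => ?_
      have := hcomp φ l hφ hl hh (hk'.trans h5)
      omega

/-! ### The derived constants of the search -/

/-- Fill `aRow` with the multiples of `n`. -/
def fillRows : Cmd :=
  assign aAcc (.const 0) ;;
  .loop iV aN (.write aRow (.var iV) (.var aAcc) ;; assign aAcc (.add (.var aAcc) (.var aN)))

/-- Increase the candidate for the cube root, unless it is large enough, and update its square and
cube. -/
def rootStep : Cmd :=
  .ite (.sub (.var aN) (.var aCube))
    (assign aCube (.add (.var aCube) (.add
      (.add (.var aSquare) (.add (.var aSquare) (.var aSquare)))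
      (.add (triple aRoot) (.const 1)))) ;;
    assign aSquare (.add (.var aSquare) (.add (.add (.var aRoot) (.var aRoot)) (.const 1))) ;;
    assign aRoot (.add (.var aRoot) (.const 1))) .skip

/-- Compute the rounded up cube root of `n`. -/
def findRoot : Cmd :=
  assign aRoot (.const 0) ;; assign aSquare (.const 0) ;; assign aCube (.const 0) ;;
  .loop iV aN rootStep

/-- Compute the number of binary digits of `n`. -/
def findLog : Cmd :=
  assign aLog (.const 0) ;; assign aPow (.const 1) ;;
  .loop iV aN (.ite (.sub (.add (.var aN) (.const 1)) (.var aPow))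
    (assign aPow (.add (.var aPow) (.var aPow)) ;; assign aLog (.add (.var aLog) (.const 1))) .skip)

/-- The constants whose computation needs only loops up to `n`. -/
def setup : Cmd :=
  assign aThree (.const 3) ;; assign aPairs (triple aN) ;; fillRows ;; findRoot ;; findLog

/-- Compute the length of the guessed seed from the cube root and the logarithm. -/
def findLen : Cmd :=
  assign aLen (.const 0) ;;
  .loop iV aRoot (.loop iC aLog (assign aLen (.add (.var aLen) (.const 336))))

/-- Compute the number of guesses by iterated multiplication. -/
def findNum : Cmd :=
  assign aNum (.const 1) ;;
  .loop iV aLen (assign aAcc (.const 0) ;;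
    .loop iC aPairs (assign aAcc (.add (.var aAcc) (.var aNum))) ;; assign aNum (.var aAcc))

lemma run_fillRows {s : State} {u : ℕ} (hu : u < s aN 0) :
    fillRows.run s aRow u = u * s aN 0 := by
  set s₀ := (assign aAcc (.const 0)).run s with hs₀
  have hn₀ : s₀ aN 0 = s aN 0 := by rw [hs₀, run_of_notMem_writes _ _ (by decide)]
  have key : (∀ u < s₀ aN 0, fillRows.run s aRow u = u * s aN 0) ∧
      fillRows.run s aAcc 0 = s₀ aN 0 * s aN 0 := by
    refine run_loop_induct (by decide) s₀ (fun k s' => (∀ u < k, s' aRow u = u * s aN 0) ∧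
      s' aAcc 0 = k * s aN 0) ?_ ?_
    · refine ⟨by simp, ?_⟩
      rw [State.set_of_ne _ _ _ (by decide), hs₀, Cmd.run]
      simp [Expr.eval]
    · intro k s' _ hk' hfr ih
      have hn : s' aN 0 = s aN 0 := by rw [hfr aN (by decide), hn₀]
      rw [State.set_of_ne _ _ _ (by decide), State.set_of_ne _ _ _ (by decide)]
      simp only [Cmd.run, Expr.eval, State.set_apply, hk', hn, ih.2]
      simp only [if_true, true_and]
      refine ⟨fun u hu => ?_, ?_⟩
      · rw [if_neg (fun h => absurd h.1 (by decide))]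
        by_cases h : u = k
        · rw [if_pos h, h]
        · rw [if_neg h]
          exact ih.1 u (by omega)
      · simp
        ring
  exact key.1 u (by rw [hn₀]; exact hu)

lemma run_findRoot (s : State) : s aN 0 ≤ findRoot.run s aRoot 0 ^ 3 ∧
    (findRoot.run s aRoot 0 = 0 ∨ (findRoot.run s aRoot 0 - 1) ^ 3 < s aN 0) := by
  set s₀ := (assign aRoot (.const 0) ;; assign aSquare (.const 0) ;; assign aCube (.const 0)).run s
    with hs₀
  have hn₀ : s₀ aN 0 = s aN 0 := by rw [hs₀, run_of_notMem_writes _ _ (by decide)]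
  have key : findRoot.run s aSquare 0 = findRoot.run s aRoot 0 ^ 2 ∧
      findRoot.run s aCube 0 = findRoot.run s aRoot 0 ^ 3 ∧
      (s aN 0 ≤ findRoot.run s aRoot 0 ^ 3 ∨ findRoot.run s aRoot 0 = s₀ aN 0) ∧
      (findRoot.run s aRoot 0 = 0 ∨ (findRoot.run s aRoot 0 - 1) ^ 3 < s aN 0) := by
    refine run_loop_induct (i := iV) (b := aN) (p := rootStep) (by decide) s₀ (fun k s' =>
      s' aSquare 0 = s' aRoot 0 ^ 2 ∧ s' aCube 0 = s' aRoot 0 ^ 3 ∧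
      (s aN 0 ≤ s' aRoot 0 ^ 3 ∨ s' aRoot 0 = k) ∧
      (s' aRoot 0 = 0 ∨ (s' aRoot 0 - 1) ^ 3 < s aN 0)) ?_ ?_
    · simp [hs₀, Cmd.run, Expr.eval, State.set_apply]
    · intro k s' _ _ hfr ih
      obtain ⟨h1, h2, h3, h4⟩ := ih
      have hn : s' aN 0 = s aN 0 := by rw [hfr aN (by decide), hn₀]
      rw [State.set_of_ne _ _ _ (by decide), State.set_of_ne _ _ _ (by decide),
        State.set_of_ne _ _ _ (by decide), rootStep, Cmd.run]
      by_cases h : s aN 0 ≤ s' aCube 0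
      · rw [if_neg (by simp only [Expr.eval, hn]; omega), Cmd.run]
        exact ⟨h1, h2, Or.inl (h2 ▸ h), h4⟩
      · rw [if_pos (by simp only [Expr.eval, hn]; omega)]
        have h5 := h3.resolve_left (h2 ▸ h)
        have e1 : ∀ r : ℕ, r ^ 2 + (r + r + 1) = (r + 1) ^ 2 := fun r => by ring
        have e2 : ∀ r : ℕ, r ^ 3 + (r ^ 2 + (r ^ 2 + r ^ 2) + (r + (r + r) + 1)) = (r + 1) ^ 3 :=
          fun r => by ring
        simp [Cmd.run, Expr.eval, State.set_apply, h1, h2, e1, e2, h5]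
        rw [← h5, ← h2]
        omega
  obtain ⟨-, -, h3, h4⟩ := key
  refine ⟨h3.elim id fun h => ?_, h4⟩
  rw [h, hn₀]
  exact Nat.le_self_pow (by omega) _

lemma run_findLog (s : State) : s aN 0 < 2 ^ findLog.run s aLog 0 ∧
    (findLog.run s aLog 0 = 0 ∨ 2 ^ (findLog.run s aLog 0 - 1) ≤ s aN 0) := by
  set s₀ := (assign aLog (.const 0) ;; assign aPow (.const 1)).run s with hs₀
  have hn₀ : s₀ aN 0 = s aN 0 := by rw [hs₀, run_of_notMem_writes _ _ (by decide)]
  have key : findLog.run s aPow 0 = 2 ^ findLog.run s aLog 0 ∧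
      (s aN 0 < 2 ^ findLog.run s aLog 0 ∨ findLog.run s aLog 0 = s₀ aN 0) ∧
      (findLog.run s aLog 0 = 0 ∨ 2 ^ (findLog.run s aLog 0 - 1) ≤ s aN 0) := by
    refine run_loop_induct (by decide) s₀ (fun k s' => s' aPow 0 = 2 ^ s' aLog 0 ∧
      (s aN 0 < 2 ^ s' aLog 0 ∨ s' aLog 0 = k) ∧
      (s' aLog 0 = 0 ∨ 2 ^ (s' aLog 0 - 1) ≤ s aN 0)) ?_ ?_
    · simp [hs₀, Cmd.run, Expr.eval, State.set_apply]
    · intro k s' _ _ hfr ih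
      obtain ⟨h2, h3, h4⟩ := ih
      have hn : s' aN 0 = s aN 0 := by rw [hfr aN (by decide), hn₀]
      rw [State.set_of_ne _ _ _ (by decide), State.set_of_ne _ _ _ (by decide), Cmd.run]
      by_cases h : s aN 0 < s' aPow 0
      · rw [if_neg (by simp only [Expr.eval, hn]; omega), Cmd.run]
        exact ⟨h2, Or.inl (h2 ▸ h), h4⟩
      · rw [if_pos (by simp only [Expr.eval, hn]; omega)]
        have h5 := h3.resolve_left (h2 ▸ h)
        have e1 : ∀ r : ℕ, 2 ^ r + 2 ^ r = 2 ^ (r + 1) := fun r => by ring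
        simp [Cmd.run, Expr.eval, State.set_apply, h2, e1, h5]
        rw [← h5, ← h2]
        omega
  obtain ⟨-, h3, h4⟩ := key
  refine ⟨h3.elim id fun h => ?_, h4⟩
  rw [h, hn₀]
  exact Nat.lt_two_pow_self

lemma run_findLen (s : State) : findLen.run s aLen 0 = 336 * s aRoot 0 * s aLog 0 := by
  set s₀ := (assign aLen (.const 0)).run s with hs₀
  have hr₀ : s₀ aRoot 0 = s aRoot 0 := by rw [hs₀, run_of_notMem_writes _ _ (by decide)]
  have hl₀ : s₀ aLog 0 = s aLog 0 := by rw [hs₀, run_of_notMem_writes _ _ (by decide)]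
  have key : findLen.run s aLen 0 = 336 * s₀ aRoot 0 * s aLog 0 := by
    refine run_loop_induct (by decide) s₀ (fun k s' => s' aLen 0 = 336 * k * s aLog 0) ?_ ?_
    · simp [hs₀, Cmd.run, Expr.eval, State.set_apply]
    · intro k s₁ _ _ hfr₁ ih
      have hl₁ : s₁ aLog 0 = s aLog 0 := by rw [hfr₁ aLog (by decide), hl₀]
      rw [State.set_of_ne _ _ _ (by decide)]
      have := run_loop_induct (i := iC) (b := aLog)
        (p := assign aLen (.add (.var aLen) (.const 336))) (by decide) s₁
        (fun j s' => s' aLen 0 = 336 * k * s aLog 0 + 336 * j) ?_ ?_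
      · rw [this, hl₁]
        ring
      · rw [State.set_of_ne _ _ _ (by decide), ih]
        simp
      · intro j s₂ _ _ _ ih₂
        rw [State.set_of_ne _ _ _ (by decide), Cmd.run, State.set_apply]
        simp only [Expr.eval, ih₂, and_self, if_true]
        ring
  rw [key, hr₀]

lemma run_findNum (s : State) : findNum.run s aNum 0 = s aPairs 0 ^ s aLen 0 := by
  set s₀ := (assign aNum (.const 1)).run s with hs₀
  have hp₀ : s₀ aPairs 0 = s aPairs 0 := by rw [hs₀, run_of_notMem_writes _ _ (by decide)]
  have hl₀ : s₀ aLen 0 = s aLen 0 := by rw [hs₀, run_of_notMem_writes _ _ (by decide)]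
  rw [← hl₀]
  refine run_loop_induct (by decide) s₀ (fun k s' => s' aNum 0 = s aPairs 0 ^ k) ?_ ?_
  · simp [hs₀, Cmd.run, Expr.eval, State.set_apply]
  · intro k s₁ _ _ hfr₁ ih
    rw [State.set_of_ne _ _ _ (by decide)]
    set s₂ := (assign aAcc (.const 0)).run s₁ with hs₂
    have hp₂ : s₂ aPairs 0 = s aPairs 0 := by
      rw [hs₂, run_of_notMem_writes _ _ (by decide), hfr₁ aPairs (by decide), hp₀]
    have hn₂ : s₂ aNum 0 = s aPairs 0 ^ k := by
      rw [hs₂, run_of_notMem_writes _ _ (by decide), ih]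
    have key := run_loop_induct (i := iC) (b := aPairs)
      (p := assign aAcc (.add (.var aAcc) (.var aNum))) (by decide) s₂
      (fun j s' => s' aAcc 0 = j * s aPairs 0 ^ k) ?_ ?_
    · change (assign aNum (.var aAcc)).run
        ((Cmd.loop iC aPairs (assign aAcc (.add (.var aAcc) (.var aNum)))).run s₂) aNum 0 = _
      rw [Cmd.run, State.set_apply]
      simp only [Expr.eval, and_self, if_true, key, hp₂]
      ring
    · simp [hs₂, Cmd.run, Expr.eval, State.set_apply]
    · intro j s₃ _ _ hfr₃ ih₃
      have hn₃ : s₃ aNum 0 = s aPairs 0 ^ k := by rw [hfr₃ aNum (by decide), hn₂]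
      rw [State.set_of_ne _ _ _ (by decide), Cmd.run, State.set_apply]
      simp only [Expr.eval, and_self, if_true, ih₃, hn₃]
      ring

lemma input_zero : input G L aN 0 = n := by simp [input]

lemma input_found : input G L aFound 0 = 0 := by simp [input]

lemma input_adj (u v : Fin n) : input G L aAdj (u * n + v) ≠ 0 ↔ G.Adj u v := by
  have h : input G L aAdj (u * n + v) ≠ 0 ↔
      ∃ u' v' : Fin n, G.Adj u' v' ∧ (u : ℕ) * n + v = u' * n + v' := by
    simp [input]
  rw [h]
  refine ⟨?_, fun h => ⟨u, v, h, rfl⟩⟩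
  rintro ⟨u', v', hadj, heq⟩
  have hn : 0 < n := u.pos
  have h1 : u = u' := Fin.ext (by
    have := congrArg (· / n) heq
    simpa [Nat.add_div_of_dvd_right (Dvd.intro_left _ rfl), Nat.mul_div_cancel _ hn,
      Nat.div_eq_of_lt v.2, Nat.div_eq_of_lt v'.2] using this)
  have h2 : v = v' := Fin.ext (by subst h1; omega)
  rwa [h1, h2]

lemma lists_input : lists n (input G L aList) = L := by
  funext v
  ext c
  have h : c ∈ lists n (input G L aList) v ↔
      ∃ (v' : Fin n) (c' : Fin 3), c' ∈ L v' ∧ 3 * (v : ℕ) + c = 3 * v' + c' := by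
    rw [mem_lists]
    simp [input]
  rw [h]
  refine ⟨?_, fun h => ⟨v, c, h, rfl⟩⟩
  rintro ⟨v', c', hc, heq⟩
  have h1 : v = v' := Fin.ext (by omega)
  have h2 : c = c' := Fin.ext (by omega)
  rwa [h1, h2]

/-- The preparations establish the constants of the search, with a seed length of
`336 k g`, where `k` and `g` are the rounded up cube root and the number of binary digits of `n`. -/
lemma run_preparations :
    ∃ k g, n ≤ k ^ 3 ∧ (k = 0 ∨ (k - 1) ^ 3 < n) ∧ n < 2 ^ g ∧ (g = 0 ∨ 2 ^ (g - 1) ≤ n) ∧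
      (setup.run (input G L)) aRoot 0 = k ∧ (setup.run (input G L)) aLog 0 = g ∧
      (findLen.run (setup.run (input G L))) aPairs 0 = 3 * n ∧
      (findLen.run (setup.run (input G L))) aLen 0 = 336 * k * g ∧
      Ready G L (336 * k * g) (findNum.run (findLen.run (setup.run (input G L)))) ∧
      (findNum.run (findLen.run (setup.run (input G L)))) aFound 0 = 0 := by
  set s₀ := input G L with hs₀
  set s₁ := (assign aThree (.const 3) ;; assign aPairs (triple aN)).run s₀ with hs₁
  set s₂ := fillRows.run s₁ with hs₂
  set s₃ := findRoot.run s₂ with hs₃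
  set s₄ := findLog.run s₃ with hs₄
  have hrun : setup.run s₀ = s₄ := rfl
  rw [hrun]
  set s₅ := findLen.run s₄ with hs₅
  set s₆ := findNum.run s₅ with hs₆
  have f₁ : ∀ a, a ≠ aThree → a ≠ aPairs → s₁ a = s₀ a := fun a h1 h2 =>
    run_of_notMem_writes _ _ (by simp [writes, h1, h2])
  have hn₀ : s₀ aN 0 = n := input_zero
  have hn₁ : s₁ aN 0 = n := by rw [f₁ aN (by decide) (by decide), hn₀]
  have hn₂ : s₂ aN 0 = n := by rw [hs₂, run_of_notMem_writes _ _ (by decide), hn₁]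
  have hn₃ : s₃ aN 0 = n := by rw [hs₃, run_of_notMem_writes _ _ (by decide), hn₂]
  have hroot := run_findRoot s₂
  have hlog := run_findLog s₃
  rw [← hs₃, hn₂] at hroot
  rw [← hs₄, hn₃] at hlog
  have hroot₄ : s₄ aRoot = s₃ aRoot := run_of_notMem_writes _ _ (by decide)
  have hthree₁ : s₁ aThree 0 = 3 := by simp [hs₁, Cmd.run, Expr.eval, State.set_apply]
  have hpairs₁ : s₁ aPairs 0 = 3 * n := by
    rw [← hn₀]
    simp [hs₁, Cmd.run, Expr.eval, State.set_apply]
    omega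
  have g₄ : ∀ a, a ∉ fillRows.writes → a ∉ findRoot.writes → a ∉ findLog.writes →
      s₄ a = s₁ a := fun a h1 h2 h3 =>
    (run_of_notMem_writes _ _ h3).trans <| (run_of_notMem_writes _ _ h2).trans <|
      run_of_notMem_writes _ _ h1
  have g₆ : ∀ a, a ∉ findLen.writes → a ∉ findNum.writes → s₆ a = s₄ a := fun a h1 h2 =>
    (run_of_notMem_writes _ _ h2).trans (run_of_notMem_writes _ _ h1)
  have hlen₅ : s₅ aLen 0 = 336 * s₃ aRoot 0 * s₄ aLog 0 := by rw [hs₅, run_findLen, hroot₄]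
  have hpairs₅ : s₅ aPairs 0 = 3 * n := by
    rw [hs₅, run_of_notMem_writes _ _ (by decide), g₄ _ (by decide) (by decide) (by decide),
      hpairs₁]
  have hin : ∀ a, a ∉ findLen.writes → a ∉ findNum.writes → a ∉ fillRows.writes →
      a ∉ findRoot.writes → a ∉ findLog.writes → a ≠ aThree → a ≠ aPairs → s₆ a = s₀ a :=
    fun a h1 h2 h3 h4 h5 h6 h7 => by rw [g₆ a h1 h2, g₄ a h3 h4 h5, f₁ a h6 h7]
  refine ⟨s₃ aRoot 0, s₄ aLog 0, hroot.1, hroot.2, hlog.1, hlog.2, by rw [hroot₄], rfl, hpairs₅,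
    hlen₅, ?_, ?_⟩
  · refine ⟨?_, fun u v => ?_, ?_, ?_, ?_, ?_, ?_⟩
    · rw [hin aN (by decide) (by decide) (by decide) (by decide) (by decide) (by decide)
        (by decide), hn₀]
    · have hrow : s₆ aRow u = u * n := by
        rw [g₆ aRow (by decide) (by decide), hs₄, run_of_notMem_writes _ _ (by decide), hs₃,
          run_of_notMem_writes _ _ (by decide), hs₂, run_fillRows (by rw [hn₁]; exact u.2), hn₁]
      rw [hrow, hin aAdj (by decide) (by decide) (by decide) (by decide) (by decide) (by decide)
        (by decide), input_adj]
    · rw [hin aList (by decide) (by decide) (by decide) (by decide) (by decide) (by decide)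
        (by decide), lists_input]
    · rw [g₆ aThree (by decide) (by decide), g₄ _ (by decide) (by decide) (by decide), hthree₁]
    · rw [g₆ aPairs (by decide) (by decide), g₄ _ (by decide) (by decide) (by decide), hpairs₁]
    · rw [hs₆, run_of_notMem_writes _ _ (by decide), hlen₅]
    · rw [hs₆, run_findNum, hpairs₅, hlen₅]
  · rw [hin aFound (by decide) (by decide) (by decide) (by decide) (by decide) (by decide)
      (by decide)]
    exact input_found

/-! ### The running time -/

/-- The whole program. -/
def main : Program :=
  .seq setup.toProgram (.seq findLen.toProgram (.seq findNum.toProgram search.toProgram))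

/-- The total size of the parts of the program. -/
def mainSize : ℕ := setup.size + findLen.size + findNum.size + search.size

/-- The greatest depth of the parts of the program. -/
def mainDepth : ℕ := max (max setup.depth findLen.depth) (max findNum.depth search.depth)

/-- The running time is polynomial in the number of guesses. -/
lemma exec_main (h : G.diam = 2) :
    ∃ (t k g : ℕ) (s : State), Exec main (input G L) t s ∧ CorrectOutput G L s ∧
      (k - 1) ^ 3 < n ∧ 2 ^ (g - 1) ≤ n ∧ 1 ≤ g ∧
      t ≤ mainSize * ((3 * n) ^ (336 * k * g) + 1) ^ mainDepth := by
  obtain ⟨k, g, hk, hk', hg, hg', hroot, hlog, hpairs, hlen, hready, hfound⟩ :=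
    run_preparations (G := G) (L := L)
  have hn : 2 ≤ n := by
    have : Nontrivial (Fin n) := SimpleGraph.nontrivial_of_diam_ne_zero (G := G) (by omega)
    exact Fin.nontrivial_iff_two_le.mp this
  have hk2 : 2 ≤ k := by
    by_contra hlt
    have : k ^ 3 ≤ 1 ^ 3 := Nat.pow_le_pow_left (by omega) 3
    omega
  have hg1 : 1 ≤ g := by
    by_contra hlt
    rw [show g = 0 by omega] at hg
    omega
  set len := 336 * k * g with hlendef
  set M := (3 * n) ^ len with hM
  have hkl : k ≤ len := by rw [hlendef]; nlinarith
  have hgl : g ≤ len := by rw [hlendef]; nlinarith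
  have hlenM : len < M := Nat.lt_pow_self (by omega)
  have hpM : 3 * n ≤ M := Nat.le_self_pow (by omega) _
  set s₁ := setup.run (input G L)
  set s₂ := findLen.run s₁
  set s₃ := findNum.run s₂
  obtain ⟨t₁, e₁, b₁⟩ := exec_toProgram (B := [aN]) (p := setup) (by decide) (M := M)
    (s := input G L) (by simp only [List.forall_mem_singleton]; rw [input_zero]; omega)
  obtain ⟨t₂, e₂, b₂⟩ := exec_toProgram (B := [aRoot, aLog]) (p := findLen) (by decide) (M := M)
    (s := s₁) (by
      simp only [List.forall_mem_cons, hroot, hlog]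
      refine ⟨?_, ?_, ?_⟩ <;> first | omega | simp)
  obtain ⟨t₃, e₃, b₃⟩ := exec_toProgram (B := [aLen, aPairs]) (p := findNum) (by decide) (M := M)
    (s := s₂) (by
      simp only [List.forall_mem_cons, hpairs, hlen]
      refine ⟨?_, ?_, ?_⟩ <;> first | omega | simp)
  obtain ⟨t₄, e₄, b₄⟩ := exec_toProgram (B := [aN, aThree, aPairs, aLen, aNum]) (p := search)
    (by decide) (M := M) (s := s₃) (by
      simp only [List.forall_mem_cons, hready.n_eq, hready.three_eq,
        hready.pairs_eq, hready.len_eq, hready.num_eq]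
      refine ⟨?_, ?_, ?_, ?_, le_rfl, ?_⟩ <;> first | omega | simp)
  refine ⟨_, k, g, _, e₁.seq (e₂.seq (e₃.seq e₄)), ?_, hk'.resolve_left (by omega),
    hg'.resolve_left (by omega), hg1, ?_⟩
  · refine run_search hready (by omega) hfound fun φ hφ => ?_
    exact exists_seed hφ.1 (exists_common_neighbor_of_diam_eq_two h) hk2 (by simpa using hk)
      (by simpa using hg)
  · set D := max (max setup.depth findLen.depth) (max findNum.depth search.depth) with hD'
    have hD : ∀ d ≤ D, ∀ z, z * (M + 1) ^ d ≤ z * (M + 1) ^ D := fun d hd z =>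
      Nat.mul_le_mul_left _ (Nat.pow_le_pow_right (by omega) hd)
    have c₁ := b₁.trans (hD _ ((le_max_left _ _).trans (le_max_left _ _)) _)
    have c₂ := b₂.trans (hD _ ((le_max_right _ _).trans (le_max_left _ _)) _)
    have c₃ := b₃.trans (hD _ ((le_max_left _ _).trans (le_max_right _ _)) _)
    have c₄ := b₄.trans (hD _ ((le_max_right _ _).trans (le_max_right _ _)) _)
    rw [← hlendef, ← hM, mainSize, add_mul, add_mul, add_mul]
    change _ ≤ _ * (M + 1) ^ D + _ * (M + 1) ^ D + _ * (M + 1) ^ D + _ * (M + 1) ^ D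
    omega

/-- With `k` about `n ^ (1 / 3)` and `g` about `log n`, a polynomial in `(3 n) ^ O(k g)` is
`2 ^ O(n ^ (1 / 3) * log² n)`. -/
lemma polynomial_le_two_rpow (K D : ℕ) {n k g t : ℕ} (hn : 3 ≤ n) (hk : (k - 1) ^ 3 < n)
    (hg : 2 ^ (g - 1) ≤ n) (hg1 : 1 ≤ g) (ht : t ≤ K * ((3 * n) ^ (336 * k * g) + 1) ^ D) :
    (t : ℝ) ≤ (2 : ℝ) ^ (((K : ℝ) + 6051 * D) * (n : ℝ) ^ ((1 : ℝ) / 3) * Real.log n ^ 2) := by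
  set r := (n : ℝ) ^ ((1 : ℝ) / 3) with hr
  set l := Real.log n with hl
  have hn' : (3 : ℝ) ≤ n := by exact_mod_cast hn
  have hr1 : 1 ≤ r := Real.one_le_rpow (by linarith) (by norm_num)
  have hl1 : 1 ≤ l := by
    rw [hl, Real.le_log_iff_exp_le (by linarith)]
    linarith [Real.exp_one_lt_d9]
  have hlog2 : (0.69 : ℝ) < Real.log 2 := by linarith [Real.log_two_gt_d9]
  have hkr : (k : ℝ) ≤ 2 * r := by
    have h1 : ((k - 1 : ℕ) : ℝ) ≤ r := by
      rw [hr, one_div, Real.le_rpow_inv_iff_of_pos (by positivity) (by positivity) (by norm_num)]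
      have : (((k - 1 : ℕ) : ℝ)) ^ (3 : ℕ) ≤ n := by exact_mod_cast hk.le
      exact_mod_cast this
    have h2 : (k : ℝ) ≤ ((k - 1 : ℕ) : ℝ) + 1 := by
      have : k ≤ (k - 1) + 1 := by omega
      exact_mod_cast this
    linarith
  have hgl : (g : ℝ) ≤ 3 * l := by
    have h1 : ((g - 1 : ℕ) : ℝ) * Real.log 2 ≤ l := by
      rw [← Real.log_pow, hl]
      exact Real.log_le_log (by positivity) (by exact_mod_cast hg)
    have h2 : (g : ℝ) = ((g - 1 : ℕ) : ℝ) + 1 := by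
      have : g = (g - 1) + 1 := by omega
      exact_mod_cast this
    nlinarith
  -- `3 n ≤ n ^ 2 ≤ 2 ^ (3 log n)`
  have h3n : (3 * n : ℝ) ≤ (2 : ℝ) ^ (3 * l) := by
    have h1 : (3 * n : ℝ) ≤ (n : ℝ) ^ 2 := by nlinarith
    refine h1.trans ?_
    rw [← Real.log_le_log_iff (by positivity) (by positivity), Real.log_pow,
      Real.log_rpow (by norm_num)]
    push_cast
    nlinarith
  have hM : ((3 * n : ℝ) ^ (336 * k * g) + 1) ≤ (2 : ℝ) ^ (6051 * r * l ^ 2) := by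
    have h1 : (1 : ℝ) ≤ (3 * n : ℝ) ^ (336 * k * g) := one_le_pow₀ (by linarith)
    have h2 : ((3 * n : ℝ) ^ (336 * k * g) + 1) ≤ (3 * n : ℝ) ^ (336 * k * g + 1) := by
      rw [pow_succ]; nlinarith
    refine h2.trans ((pow_le_pow_left₀ (by positivity) h3n _).trans ?_)
    rw [← Real.rpow_natCast, ← Real.rpow_mul (by norm_num)]
    refine Real.rpow_le_rpow_of_exponent_le (by norm_num) ?_
    push_cast
    have h3 : (k : ℝ) * g ≤ 2 * r * (3 * l) :=
      mul_le_mul hkr hgl (by positivity) (by positivity)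
    have h4 : (1 : ℝ) ≤ r * l := by nlinarith
    have h5 : (336 * (k : ℝ) * g + 1) ≤ 2017 * (r * l) := by nlinarith
    nlinarith [mul_le_mul_of_nonneg_left h5 (show (0 : ℝ) ≤ 3 * l by linarith)]
  have hK : (K : ℝ) ≤ (2 : ℝ) ^ ((K : ℝ) * r * l ^ 2) := by
    have h1 : (K : ℝ) ≤ (2 : ℝ) ^ (K : ℝ) := by
      rw [Real.rpow_natCast]
      exact_mod_cast Nat.lt_two_pow_self.le
    refine h1.trans (Real.rpow_le_rpow_of_exponent_le (by norm_num) ?_)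
    have h2 : (1 : ℝ) ≤ r * l ^ 2 := by nlinarith [mul_le_mul hl1 hl1 (by norm_num) (by linarith)]
    nlinarith [Nat.cast_nonneg (α := ℝ) K]
  calc (t : ℝ) ≤ K * ((3 * n : ℝ) ^ (336 * k * g) + 1) ^ D := by exact_mod_cast ht
    _ ≤ (2 : ℝ) ^ ((K : ℝ) * r * l ^ 2) * ((2 : ℝ) ^ (6051 * r * l ^ 2)) ^ D :=
        mul_le_mul hK (pow_le_pow_left₀ (by positivity) hM _) (by positivity) (by positivity)
    _ = _ := by
        rw [← Real.rpow_mul_natCast (by norm_num), ← Real.rpow_add (by norm_num)]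
        congr 1
        ring

end Algo

end ListThreeColoring

/-- List 3-Coloring on `n`-vertex graphs of diameter `2` can be solved in time
`2 ^ O(n ^ (1/3) * log² n)`. -/
theorem mainTheorem1 :
    ∃ (P : RAM.Program) (C : ℝ),
      ∀ (n : ℕ) (G : SimpleGraph (Fin n)) (L : Fin n → Finset (Fin 3)), G.diam = 2 →
        ∃ (t : ℕ) (s : RAM.State),
          RAM.Exec P (ListThreeColoring.input G L) t s ∧
          (t : ℝ) ≤ (2 : ℝ) ^ (C * (n : ℝ) ^ ((1 : ℝ) / 3) * Real.log (n : ℝ) ^ 2) ∧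
          ListThreeColoring.CorrectOutput G L s := by
  refine ⟨ListThreeColoring.Algo.main, (ListThreeColoring.Algo.mainSize : ℝ) +
    6051 * ListThreeColoring.Algo.mainDepth, fun n G L h => ?_⟩
  obtain ⟨t, k, g, s, hexec, hout, hk, hg, hg1, ht⟩ :=
    ListThreeColoring.Algo.exec_main (L := L) h
  exact ⟨t, s, hexec, ListThreeColoring.Algo.polynomial_le_two_rpow _ _
    (ListThreeColoring.three_le_of_diam_eq_two h) hk hg hg1 ht, hout⟩
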